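/- Let $\Omega\subset\mathbb{R}^4$ be a bounded open set, and let $H^2_0(\Omega)$ be the closure of $C_c^\infty(\Omega)$ in the (real) Sobolev space $H^2(\Omega)=W^{2,2}(\Omega)$. For a measurable function $f$ on $\Omega$ that is finite a.e., let $f^*(t)=\inf\{s>0: |\{x\in\Omega: |f(x)|>s\}|<t\}$ ($t>0$) be its decreasing rearrangement, let $f^{**}(t)=\frac1t\int_0^t f^*(\tau)\,d\tau$, and put $$|f|_{(\infty,2,-1)}=\left(\int_0^{|\Omega|}\left(\frac{f^*(t)}{\log(e|\Omega|/t)}\right)^2\frac{dt}{t}\right)^{1/2},\qquad \|f\|_{(\infty,2,-1)}=\left(\int_0^{|\Omega|}\left(\frac{f^{**}(t)}{\log(e|\Omega|/t)}\right)^2\frac{dt}{t}\right)^{1/2}.$$ The Lorentz–Zygmund space $L^{\infty,2}(\log L)^{-1}(\Omega)$ consists of the $f$ with $|f|_{(\infty,2,-1)}<\infty$ and is normed by $\|\cdot\|_{(\infty,2,-1)}$. Then $H^2_0(\Omega)$ embeds continuously into $L^{\infty,2}(\log L)^{-1}(\Omega)$. That is, there is a constant $C=C(\Omega)$ such that every $u\in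 H^2_0(\Omega)$ belongs to $L^{\infty,2}(\log L)^{-1}(\Omega)$ and satisfies $$|u|_{(\infty,2,-1)}\le C\,\|\Delta u\|_{L^2(\Omega)},\qquad \|u\|_{(\infty,2,-1)}\le C\,\|\Delta u\|_{L^2(\Omega)}\qquad\text{and}\qquad \|u\|_{(\infty,2,-1)}\le C\,\|u\|_{H^2(\Omega)}.$$ -/

import Mathlib

open MeasureTheory TopologicalSpace
open scoped ENNReal NNReal Distributions

namespace LorentzZygmund

noncomputable section

/-! ### The Sobolev space `H²₀(Ω)`

Functions on `Ω` are represented by functions on the whole space whose values outside `Ω` play no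
role, and, as usual, functions that agree almost everywhere on `Ω` are not distinguished. -/

/-- `v` is the weak partial derivative `∂ᵢ u` on the open set `Ω`: both functions are locally
integrable on `Ω`, and `∫_Ω u ∂ᵢφ = - ∫_Ω v φ` for every test function `φ ∈ C_c^∞(Ω)`. -/
def IsWeakPartial {N : ℕ} (Ω : Opens (EuclideanSpace ℝ (Fin N))) (i : Fin N)
    (u v : EuclideanSpace ℝ (Fin N) → ℝ) : Prop :=
  LocallyIntegrableOn u (Ω : Set (EuclideanSpace ℝ (Fin N))) ∧
  LocallyIntegrableOn v (Ω : Set (EuclideanSpace ℝ (Fin N))) ∧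
  ∀ φ : 𝓓(Ω, ℝ),
    ∫ x in (Ω : Set (EuclideanSpace ℝ (Fin N))),
        u x * lineDeriv ℝ φ x (EuclideanSpace.single i (1 : ℝ)) =
      - ∫ x in (Ω : Set (EuclideanSpace ℝ (Fin N))), v x * φ x

open Classical in
/-- The weak partial derivative `∂ᵢ u` on `Ω` (unique up to a null set), and `0` if there is
none. -/
def weakPartial {N : ℕ} (Ω : Opens (EuclideanSpace ℝ (Fin N))) (i : Fin N)
    (u : EuclideanSpace ℝ (Fin N) → ℝ) : EuclideanSpace ℝ (Fin N) → ℝ :=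
  if h : ∃ v, IsWeakPartial Ω i u v then h.choose else 0

/-- The weak Laplacian `Δu = ∑ᵢ ∂ᵢ∂ᵢ u` on `Ω`. -/
def weakLaplacian {N : ℕ} (Ω : Opens (EuclideanSpace ℝ (Fin N)))
    (u : EuclideanSpace ℝ (Fin N) → ℝ) : EuclideanSpace ℝ (Fin N) → ℝ :=
  fun x => ∑ i, weakPartial Ω i (weakPartial Ω i u) x

/-- The norm of `L²(Ω)`. -/
def l2Norm {N : ℕ} (Ω : Opens (EuclideanSpace ℝ (Fin N)))
    (u : EuclideanSpace ℝ (Fin N) → ℝ) : ℝ≥0∞ :=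
  eLpNorm u 2 (volume.restrict (Ω : Set (EuclideanSpace ℝ (Fin N))))

/-- Membership in the Sobolev space `H²(Ω) = W^{2,2}(Ω)`: the function is in `L²(Ω)` and its weak
partial derivatives of orders one and two exist and are in `L²(Ω)`. -/
structure MemH2 {N : ℕ} (Ω : Opens (EuclideanSpace ℝ (Fin N)))
    (u : EuclideanSpace ℝ (Fin N) → ℝ) : Prop where
  memLp : MemLp u 2 (volume.restrict (Ω : Set (EuclideanSpace ℝ (Fin N))))
  exists_first : ∀ i, ∃ v, IsWeakPartial Ω i u v
  memLp_first : ∀ i, MemLp (weakPartial Ω i u) 2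
    (volume.restrict (Ω : Set (EuclideanSpace ℝ (Fin N))))
  exists_second : ∀ i j, ∃ v, IsWeakPartial Ω j (weakPartial Ω i u) v
  memLp_second : ∀ i j, MemLp (weakPartial Ω j (weakPartial Ω i u)) 2
    (volume.restrict (Ω : Set (EuclideanSpace ℝ (Fin N))))

/-- The norm of `H²(Ω)`: the square root of the sum of the squared `L²(Ω)` norms of the function
and of its weak partial derivatives of orders one and two. -/
def h2Norm {N : ℕ} (Ω : Opens (EuclideanSpace ℝ (Fin N)))
    (u : EuclideanSpace ℝ (Fin N) → ℝ) : ℝ≥0∞ :=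
  (l2Norm Ω u ^ 2 + ∑ i, l2Norm Ω (weakPartial Ω i u) ^ 2 +
    ∑ i, ∑ j, l2Norm Ω (weakPartial Ω j (weakPartial Ω i u)) ^ 2) ^ (1 / 2 : ℝ)

/-- Membership in `H²₀(Ω)`, the closure of `C_c^∞(Ω)` in `H²(Ω)`. -/
def MemH20 {N : ℕ} (Ω : Opens (EuclideanSpace ℝ (Fin N)))
    (u : EuclideanSpace ℝ (Fin N) → ℝ) : Prop :=
  MemH2 Ω u ∧ ∀ ε : ℝ≥0∞, 0 < ε → ∃ φ : 𝓓(Ω, ℝ), h2Norm Ω (fun x => u x - φ x) < ε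

/-! ### Rearrangements and Lorentz–Zygmund spaces -/

/-- The distribution function `s ↦ |{x ∈ Ω : |f x| > s}|`. -/
def distribFun {N : ℕ} (Ω : Opens (EuclideanSpace ℝ (Fin N)))
    (f : EuclideanSpace ℝ (Fin N) → ℝ) (s : ℝ≥0∞) : ℝ≥0∞ :=
  volume {x | x ∈ Ω ∧ s < ‖f x‖ₑ}

/-- The decreasing rearrangement `f*` on `[0, ∞)`: the essential supremum of `|f|` at `t = 0`, and
`f*(t) = inf {s > 0 : |{|f| > s}| < t}` for `t > 0`. -/
def rearr {N : ℕ} (Ω : Opens (EuclideanSpace ℝ (Fin N)))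
    (f : EuclideanSpace ℝ (Fin N) → ℝ) (t : ℝ) : ℝ≥0∞ :=
  if t = 0 then
    essSup (fun x => ‖f x‖ₑ) (volume.restrict (Ω : Set (EuclideanSpace ℝ (Fin N))))
  else sInf {s : ℝ≥0∞ | 0 < s ∧ distribFun Ω f s < ENNReal.ofReal t}

/-- The maximal function `f**(t) = (1/t) ∫₀ᵗ f*(τ) dτ`, for `t > 0`. -/
def maxRearr {N : ℕ} (Ω : Opens (EuclideanSpace ℝ (Fin N)))
    (f : EuclideanSpace ℝ (Fin N) → ℝ) (t : ℝ) : ℝ≥0∞ :=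
  (∫⁻ τ in Set.Ioo 0 t, rearr Ω f τ) / ENNReal.ofReal t

/-- The weight `(log (e|Ω|/t))^α t^{1/p - 1/q}` on `(0, |Ω|)`, with `1/∞ = 0`. -/
def lzWeight {N : ℕ} (Ω : Opens (EuclideanSpace ℝ (Fin N))) (p q : ℝ≥0∞) (α : ℝ) (t : ℝ) : ℝ≥0∞ :=
  ENNReal.ofReal
    (Real.log (Real.exp 1 * (volume (Ω : Set (EuclideanSpace ℝ (Fin N)))).toReal / t) ^ α *
      t ^ ((p⁻¹).toReal - (q⁻¹).toReal))

/-- The Lorentz–Zygmund quasinorm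
`|f|_{(p,q,α)} = ‖(log (e|Ω|/t))^α t^{1/p - 1/q} f*(t)‖_{L^q((0,|Ω|))}`. -/
def lzQuasinorm {N : ℕ} (Ω : Opens (EuclideanSpace ℝ (Fin N))) (p q : ℝ≥0∞) (α : ℝ)
    (f : EuclideanSpace ℝ (Fin N) → ℝ) : ℝ≥0∞ :=
  eLpNorm (fun t : ℝ => lzWeight Ω p q α t * rearr Ω f t) q
    (volume.restrict (Set.Ioo 0 (volume (Ω : Set (EuclideanSpace ℝ (Fin N)))).toReal))

/-- The Lorentz–Zygmund norm (for `p > 1`)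
`‖f‖_{(p,q,α)} = ‖(log (e|Ω|/t))^α t^{1/p - 1/q} f**(t)‖_{L^q((0,|Ω|))}`. -/
def lzNorm {N : ℕ} (Ω : Opens (EuclideanSpace ℝ (Fin N))) (p q : ℝ≥0∞) (α : ℝ)
    (f : EuclideanSpace ℝ (Fin N) → ℝ) : ℝ≥0∞ :=
  eLpNorm (fun t : ℝ => lzWeight Ω p q α t * maxRearr Ω f t) q
    (volume.restrict (Set.Ioo 0 (volume (Ω : Set (EuclideanSpace ℝ (Fin N)))).toReal))

/-- Membership in the Lorentz–Zygmund space `L^{p,q}(log L)^α(Ω)` of a bounded open set `Ω`: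
Lebesgue measurable functions on `Ω` with finite quasinorm. -/
def MemLorentzZygmund {N : ℕ} (Ω : Opens (EuclideanSpace ℝ (Fin N))) (p q : ℝ≥0∞) (α : ℝ)
    (f : EuclideanSpace ℝ (Fin N) → ℝ) : Prop :=
  AEMeasurable f (volume.restrict (Ω : Set (EuclideanSpace ℝ (Fin N)))) ∧
    lzQuasinorm Ω p q α f < ∞

end

end LorentzZygmund

/-! On `ℝ⁴` a test function is a potential of order two of its second derivatives, and the claim is
the limiting case of the Sobolev inequality for such potentials, read off from rearrangements.

Integrating `r ∂ᵥ²φ(x + r v)` along rays and averaging over `v` in the unit ball bounds `|φ(x)|` by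
`∫₀^∞ r⁻³ ∫_{B(x,r)} g dy dr`, where `g = hessSum φ`; up to a constant this is the convolution of
`g` with `|·|⁻²` (`IsTest.enorm_le_lintegral_ball`). Splitting the radii where the ball has volume
`t` gives an O'Neil type inequality (`rearr_half_le`): `φ*(t/2)` is at most a constant times
`t^(-1/2) ∫₀ᵗ g* + ∫ₜ^∞ τ^(-1/2) g*`.

The weight `t^(-1/2) / log(e|Ω|/t)` carries both terms into `L²(0,|Ω|)`. The first needs only
Hardy's inequality for averages (`hardy_average`), since the logarithm is at least one. The second
is a Hardy inequality for tails (`hardy_log`), where the logarithmic factor is what makes the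
estimate possible. Both follow from the Schur test. Finally `‖g*‖₂ ≤ ‖g‖₂ ≤ 4 ‖Δφ‖₂`, because
integration by parts turns the `L²` norm of the Hessian into that of the Laplacian.

A general `u` is approximated in `H²` by test functions. Chebyshev's inequality compares `u*(t)`
with `φ*(t/2)`, and Fatou's lemma passes to the limit (`lzQuasinorm_le`). The norm built on `u**` is
controlled by the quasinorm through one more weighted Hardy inequality (`hardy_average_log`), and
the bound by the `H²` norm holds because the Laplacian is a sum of four second derivatives. -/

namespace LorentzZygmund

/-! ### Comparing integrals through distribution functions -/

section LayerCake

variable {α β : Type*} [MeasurableSpace α] [MeasurableSpace β]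

theorem volume_setOf_ofReal_lt (a : ℝ≥0∞) :
    volume {s : ℝ | 0 < s ∧ ENNReal.ofReal s < a} = a := by
  rcases eq_or_ne a ∞ with rfl | ha
  · have : {s : ℝ | 0 < s ∧ ENNReal.ofReal s < ∞} = Set.Ioi 0 := by
      ext s; simp
    rw [this, Real.volume_Ioi]
  · have : {s : ℝ | 0 < s ∧ ENNReal.ofReal s < a} = Set.Ioo 0 a.toReal := by
      ext s
      simp only [Set.mem_ofPred_eq, Set.mem_Ioo, and_congr_right_iff]
      intro _
      exact ENNReal.ofReal_lt_iff_lt_toReal (by linarith) ha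
    rw [this, Real.volume_Ioo, sub_zero, ENNReal.ofReal_toReal ha]

/-- The layer cake formula for functions with values in `[0, ∞]`. -/
theorem lintegral_eq_lintegral_meas_ofReal_lt (μ : Measure α) [SFinite μ] {F : α → ℝ≥0∞}
    (hF : AEMeasurable F μ) :
    ∫⁻ x, F x ∂μ = ∫⁻ s in Set.Ioi (0 : ℝ), μ {x | ENNReal.ofReal s < F x} := by
  have key : ∀ G : α → ℝ≥0∞, Measurable G →
      ∫⁻ x, G x ∂μ = ∫⁻ s in Set.Ioi (0 : ℝ), μ {x | ENNReal.ofReal s < G x} := by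
    intro G hG
    have hS : MeasurableSet {p : α × ℝ | ENNReal.ofReal p.2 < G p.1} :=
      measurableSet_lt (by fun_prop) (by fun_prop)
    calc ∫⁻ x, G x ∂μ
        = ∫⁻ x, (∫⁻ s in Set.Ioi (0 : ℝ),
            {p : α × ℝ | ENNReal.ofReal p.2 < G p.1}.indicator 1 (x, s)) ∂μ := by
          refine lintegral_congr fun x => ?_
          have h1 : (fun s : ℝ => {p : α × ℝ | ENNReal.ofReal p.2 < G p.1}.indicator
              (1 : α × ℝ → ℝ≥0∞) (x, s)) = {s : ℝ | ENNReal.ofReal s < G x}.indicator 1 := by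
            ext s; simp [Set.indicator]
          have hm : MeasurableSet {s : ℝ | ENNReal.ofReal s < G x} :=
            measurableSet_lt (by fun_prop) (by fun_prop)
          rw [h1, lintegral_indicator_one hm, Measure.restrict_apply hm]
          conv_lhs => rw [← volume_setOf_ofReal_lt (G x)]
          congr 1
          ext s
          simp [and_comm]
      _ = ∫⁻ s in Set.Ioi (0 : ℝ), (∫⁻ x,
            {p : α × ℝ | ENNReal.ofReal p.2 < G p.1}.indicator 1 (x, s) ∂μ) := by
          rw [lintegral_lintegral_swap]
          exact ((measurable_one.indicator hS)).aemeasurable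
      _ = _ := by
          refine lintegral_congr fun s => ?_
          have h1 : (fun x : α => {p : α × ℝ | ENNReal.ofReal p.2 < G p.1}.indicator
              (1 : α × ℝ → ℝ≥0∞) (x, s)) = {x : α | ENNReal.ofReal s < G x}.indicator 1 := by
            ext s; simp [Set.indicator]
          rw [h1, lintegral_indicator_one (measurableSet_lt (by fun_prop) (by fun_prop))]
  rw [lintegral_congr_ae hF.ae_eq_mk, key _ hF.measurable_mk]
  refine lintegral_congr fun s => measure_congr ?_
  filter_upwards [hF.ae_eq_mk] with x hx
  simp only [eq_iff_iff]
  change (ENNReal.ofReal s < hF.mk F x) ↔ (ENNReal.ofReal s < F x)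
  rw [hx]

/-- By the layer cake formula an inequality of distribution functions integrates. With it, estimates
between `f` and `f*` need only inclusions of level sets, not full equimeasurability. -/
theorem lintegral_le_of_meas_lt_le {μ : Measure α} [SFinite μ] {ν : Measure β} [SFinite ν]
    {F : α → ℝ≥0∞} {H : β → ℝ≥0∞} (hF : AEMeasurable F μ) (hH : AEMeasurable H ν)
    (h : ∀ s : ℝ, 0 < s → μ {x | ENNReal.ofReal s < F x} ≤ ν {y | ENNReal.ofReal s < H y}) :
    ∫⁻ x, F x ∂μ ≤ ∫⁻ y, H y ∂ν := by
  rw [lintegral_eq_lintegral_meas_ofReal_lt μ hF, lintegral_eq_lintegral_meas_ofReal_lt ν hH]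
  exact setLIntegral_mono' measurableSet_Ioi fun s hs => h s hs

end LayerCake

/-! ### Decreasing rearrangements -/

section Rearrangement

variable {N : ℕ} {Ω : Opens (EuclideanSpace ℝ (Fin N))} {f h : EuclideanSpace ℝ (Fin N) → ℝ}

theorem distribFun_anti {s s' : ℝ≥0∞} (hs : s ≤ s') : distribFun Ω f s' ≤ distribFun Ω f s :=
  measure_mono fun _ hx => ⟨hx.1, hs.trans_lt hx.2⟩

theorem rearr_of_pos {t : ℝ} (ht : 0 < t) :
    rearr Ω f t = sInf {s : ℝ≥0∞ | 0 < s ∧ distribFun Ω f s < ENNReal.ofReal t} :=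
  if_neg ht.ne'

theorem ofReal_le_distribFun_of_lt_rearr {t : ℝ} (ht : 0 < t) {s : ℝ≥0∞}
    (hs : s < rearr Ω f t) : ENNReal.ofReal t ≤ distribFun Ω f s := by
  obtain ⟨s', hs', hs''⟩ := exists_between hs
  by_contra! hlt
  rw [rearr_of_pos ht] at hs''
  exact hs''.not_ge (sInf_le ⟨(zero_le).trans_lt hs', (distribFun_anti hs'.le).trans_lt hlt⟩)

theorem le_rearr_of_ofReal_le_distribFun {t : ℝ} (ht : 0 < t) {s : ℝ≥0∞}
    (hs : ENNReal.ofReal t ≤ distribFun Ω f s) : s ≤ rearr Ω f t := by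
  rw [rearr_of_pos ht]
  refine le_sInf fun s' hs' => ?_
  by_contra! hlt
  exact (hs.trans (distribFun_anti hlt.le)).not_gt hs'.2

/-- The strict conclusion rests on right continuity of the distribution function: `{|f| > s}` is the
increasing union of `{|f| > v n}` for `v n` decreasing to `s`, so some level above `s` already has a
superlevel set larger than `t`. -/
theorem lt_rearr_of_ofReal_lt_distribFun {t : ℝ} (ht : 0 < t) {s : ℝ≥0∞}
    (hs : ENNReal.ofReal t < distribFun Ω f s) : s < rearr Ω f t := by
  have hs_top : s < ∞ := by
    by_contra! hcon
    obtain rfl := top_le_iff.1 hcon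
    simp [distribFun] at hs
  obtain ⟨v, hv_anti, hv_mem, hv_lim⟩ := exists_seq_strictAnti_tendsto' hs_top
  have hU : {x | x ∈ Ω ∧ s < ‖f x‖ₑ} = ⋃ n, {x | x ∈ Ω ∧ v n < ‖f x‖ₑ} := by
    ext x
    simp only [Set.mem_ofPred_eq, Set.mem_iUnion]
    constructor
    · rintro ⟨hx, hlt⟩
      obtain ⟨n, hn⟩ := (hv_lim.eventually (gt_mem_nhds hlt)).exists
      exact ⟨n, hx, hn⟩
    · rintro ⟨n, hx, hlt⟩
      exact ⟨hx, (hv_mem n).1.trans hlt⟩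
  have hmono : Monotone fun n => {x | x ∈ Ω ∧ v n < ‖f x‖ₑ} := fun m n hmn x hx =>
    ⟨hx.1, (hv_anti.antitone hmn).trans_lt hx.2⟩
  unfold distribFun at hs
  rw [hU, hmono.measure_iUnion, lt_iSup_iff] at hs
  obtain ⟨n, hn⟩ := hs
  exact (hv_mem n).1.trans_le (le_rearr_of_ofReal_le_distribFun ht hn.le)

theorem rearr_antitoneOn : AntitoneOn (rearr Ω f) (Set.Ioi 0) := by
  intro t ht t' ht' htt'
  rw [rearr_of_pos ht, rearr_of_pos ht']
  exact sInf_le_sInf fun s hs => ⟨hs.1, hs.2.trans_le (ENNReal.ofReal_le_ofReal htt')⟩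

theorem aemeasurable_rearr : AEMeasurable (rearr Ω f) (volume.restrict (Set.Ioi 0)) :=
  aemeasurable_restrict_of_antitoneOn measurableSet_Ioi rearr_antitoneOn

theorem aemeasurable_rearr_mono {S : Set ℝ} (hS : S ⊆ Set.Ioi 0) :
    AEMeasurable (rearr Ω f) (volume.restrict S) :=
  aemeasurable_rearr.mono_measure (Measure.restrict_mono hS le_rfl)

theorem rearr_eq_zero {t : ℝ} (ht : 0 < t)
    (h : volume (Ω : Set (EuclideanSpace ℝ (Fin N))) < ENNReal.ofReal t) : rearr Ω f t = 0 := by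
  by_contra hne
  have h1 := ofReal_le_distribFun_of_lt_rearr ht (pos_iff_ne_zero.2 hne)
  exact (h1.trans (measure_mono fun x hx => hx.1)).not_gt h

theorem lintegral_rearr_sq_le (hf : AEMeasurable f
    (volume.restrict (Ω : Set (EuclideanSpace ℝ (Fin N))))) :
    ∫⁻ t in Set.Ioi 0, rearr Ω f t ^ 2 ≤
      ∫⁻ x in (Ω : Set (EuclideanSpace ℝ (Fin N))), ‖f x‖ₑ ^ 2 := by
  refine lintegral_le_of_meas_lt_le (aemeasurable_rearr.pow_const 2)
    (hf.enorm.pow_const 2) fun s hs => ?_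
  have hsq : ∀ a : ℝ≥0∞, ENNReal.ofReal s < a ^ 2 ↔ ENNReal.ofReal √s < a := by
    intro a
    have h1 : ENNReal.ofReal s = ENNReal.ofReal √s ^ 2 := by
      rw [← ENNReal.ofReal_pow (Real.sqrt_nonneg _), Real.sq_sqrt hs.le]
    rw [h1]
    exact ENNReal.pow_lt_pow_left_iff two_ne_zero
  simp only [hsq]
  have h2 : (volume.restrict (Ω : Set (EuclideanSpace ℝ (Fin N))))
      {x | ENNReal.ofReal √s < ‖f x‖ₑ} = distribFun Ω f (ENNReal.ofReal √s) := by
    rw [Measure.restrict_apply' Ω.isOpen.measurableSet, distribFun]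
    congr 1
    ext x
    simp [and_comm]
  rw [h2, Measure.restrict_apply' measurableSet_Ioi]
  rcases eq_or_ne (distribFun Ω f (ENNReal.ofReal √s)) ∞ with htop | htop
  · rw [htop]; exact le_top
  · calc volume ({t | ENNReal.ofReal √s < rearr Ω f t} ∩ Set.Ioi 0)
        ≤ volume (Set.Ioc 0 (distribFun Ω f (ENNReal.ofReal √s)).toReal) := by
          refine measure_mono ?_
          rintro t ⟨ht, ht0⟩
          exact ⟨ht0, (ENNReal.ofReal_le_iff_le_toReal htop).1
            (ofReal_le_distribFun_of_lt_rearr ht0 ht)⟩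
      _ = _ := by rw [Real.volume_Ioc, sub_zero, ENNReal.ofReal_toReal htop]

/-- The part of `|f|` above the level `f*(t)`, together with the level times `t`, has at most the
integral of `f*` over `(0, t)`. -/
theorem lintegral_sub_rearr_add_le (hf : AEMeasurable f
    (volume.restrict (Ω : Set (EuclideanSpace ℝ (Fin N))))) {t : ℝ} (ht : 0 < t) :
    (∫⁻ x in (Ω : Set (EuclideanSpace ℝ (Fin N))), (‖f x‖ₑ - rearr Ω f t)) +
      rearr Ω f t * ENNReal.ofReal t ≤ ∫⁻ τ in Set.Ioo 0 t, rearr Ω f τ := by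
  rcases eq_or_ne (rearr Ω f t) ∞ with htop | htop
  -- An infinite level cannot be subtracted; here monotonicity makes `f*` infinite on all of `(0,
  -- t)`.
  · have hI : ∫⁻ τ in Set.Ioo 0 t, rearr Ω f τ = ∞ := by
      rw [eq_top_iff]
      calc ∞ = ∫⁻ τ in Set.Ioo 0 t, ∞ := by simp [ht]
        _ ≤ _ := setLIntegral_mono' measurableSet_Ioo fun τ hτ =>
            htop ▸ rearr_antitoneOn hτ.1 ht hτ.2.le
    rw [hI]; exact le_top
  have hm : AEMeasurable (fun τ => rearr Ω f τ - rearr Ω f t) (volume.restrict (Set.Ioo 0 t)) :=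
    (aemeasurable_rearr_mono Set.Ioo_subset_Ioi_self).sub_const _
  have h1 : ∫⁻ x in (Ω : Set (EuclideanSpace ℝ (Fin N))), (‖f x‖ₑ - rearr Ω f t) ≤
      ∫⁻ τ in Set.Ioo 0 t, (rearr Ω f τ - rearr Ω f t) := by
    refine lintegral_le_of_meas_lt_le (hf.enorm.sub_const _) hm fun s hs => ?_
    simp only [lt_tsub_iff_right]
    set a := ENNReal.ofReal s + rearr Ω f t with ha
    have h2 : (volume.restrict (Ω : Set (EuclideanSpace ℝ (Fin N))))
        {x | a < ‖f x‖ₑ} = distribFun Ω f a := by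
      rw [Measure.restrict_apply' Ω.isOpen.measurableSet, distribFun]
      congr 1
      ext x
      simp [and_comm]
    have hlt : rearr Ω f t < a := by
      rw [ha, add_comm]
      exact ENNReal.lt_add_right htop (by simpa using hs)
    have hle : distribFun Ω f a ≤ ENNReal.ofReal t := by
      by_contra! hcon
      exact (lt_rearr_of_ofReal_lt_distribFun ht hcon).not_gt hlt
    have hfin : distribFun Ω f a ≠ ∞ := (hle.trans_lt ENNReal.ofReal_lt_top).ne
    rw [h2, Measure.restrict_apply' measurableSet_Ioo]
    calc distribFun Ω f a = volume (Set.Ioo 0 (distribFun Ω f a).toReal) := by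
          rw [Real.volume_Ioo, sub_zero, ENNReal.ofReal_toReal hfin]
      _ ≤ _ := by
          refine measure_mono fun τ hτ => ?_
          have h3 : a < rearr Ω f τ := lt_rearr_of_ofReal_lt_distribFun hτ.1
            ((ENNReal.ofReal_lt_iff_lt_toReal hτ.1.le hfin).2 hτ.2)
          exact ⟨h3, hτ.1, hτ.2.trans_le (ENNReal.toReal_le_of_le_ofReal ht.le hle)⟩
  calc _ ≤ (∫⁻ τ in Set.Ioo 0 t, (rearr Ω f τ - rearr Ω f t)) +
        ∫⁻ τ in Set.Ioo 0 t, rearr Ω f t := by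
        gcongr
        simp
    _ = ∫⁻ τ in Set.Ioo 0 t, ((rearr Ω f τ - rearr Ω f t) + rearr Ω f t) := by
        rw [lintegral_add_left' hm]
    _ = _ := setLIntegral_congr_fun measurableSet_Ioo fun τ hτ =>
        tsub_add_cancel_of_le (rearr_antitoneOn hτ.1 ht hτ.2.le)

/-- A superlevel set of `f` is covered by one of `h` and one of `f - h`; each is allotted measure `t
/ 2`, and Chebyshev's inequality in `L²` handles the second. This transfers bounds from test
functions to their `H²` limits. -/
theorem rearr_le_rearr_half_add {t : ℝ} (ht : 0 < t)
    (hfh : AEMeasurable (fun x => f x - h x)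
      (volume.restrict (Ω : Set (EuclideanSpace ℝ (Fin N))))) :
    rearr Ω f t ≤ rearr Ω h (t / 2) +
      l2Norm Ω (fun x => f x - h x) * ENNReal.ofReal (2 / t) ^ (1 / 2 : ℝ) := by
  set n := l2Norm Ω (fun x => f x - h x) with hn
  set b := n * ENNReal.ofReal (2 / t) ^ (1 / 2 : ℝ) with hb
  have ht2 : 0 < t / 2 := by linarith
  by_contra! hlt
  set p := rearr Ω h (t / 2) with hp
  -- A level strictly above `b` with `p + b'` still below `f*(t)`: the set `{|f| > p + b'}` then has
  -- measure at least `t`, while Chebyshev will force `b' ≤ b`.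
  obtain ⟨b', hbb', hb'⟩ := exists_between (lt_tsub_iff_left.2 hlt)
  rw [lt_tsub_iff_left] at hb'
  have h1 := ofReal_le_distribFun_of_lt_rearr ht hb'
  have h2 : distribFun Ω h p ≤ ENNReal.ofReal (t / 2) := by
    by_contra! hcon
    exact lt_irrefl _ (lt_rearr_of_ofReal_lt_distribFun ht2 hcon)
  have h3 : b' ^ 2 * (volume.restrict (Ω : Set (EuclideanSpace ℝ (Fin N))))
      {x | b' ≤ ‖f x - h x‖ₑ} ≤ n ^ 2 := by
    have := mul_meas_ge_le_pow_eLpNorm' (p := 2)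
      (volume.restrict (Ω : Set (EuclideanSpace ℝ (Fin N)))) two_ne_zero ENNReal.ofNat_ne_top
      hfh.aestronglyMeasurable b'
    simpa [hn, l2Norm] using this
  have h4 : distribFun Ω f (p + b') ≤ distribFun Ω h p +
      (volume.restrict (Ω : Set (EuclideanSpace ℝ (Fin N)))) {x | b' ≤ ‖f x - h x‖ₑ} := by
    rw [Measure.restrict_apply' Ω.isOpen.measurableSet]
    refine (measure_mono ?_).trans (measure_union_le _ _)
    rintro x ⟨hx, hlt⟩
    by_cases hxp : p < ‖h x‖ₑ
    · exact Or.inl ⟨hx, hxp⟩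
    · refine Or.inr ⟨?_, hx⟩
      change b' ≤ ‖f x - h x‖ₑ
      by_contra! hcon
      have : ‖f x‖ₑ ≤ p + b' := calc
        ‖f x‖ₑ = ‖h x + (f x - h x)‖ₑ := by congr 1; ring
        _ ≤ ‖h x‖ₑ + ‖f x - h x‖ₑ := enorm_add_le _ _
        _ ≤ p + b' := add_le_add (not_lt.1 hxp) hcon.le
      exact this.not_gt hlt
  have h5 : ENNReal.ofReal (t / 2) ≤
      (volume.restrict (Ω : Set (EuclideanSpace ℝ (Fin N)))) {x | b' ≤ ‖f x - h x‖ₑ} := by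
    have h6 : ENNReal.ofReal (t / 2) + ENNReal.ofReal (t / 2) ≤ ENNReal.ofReal (t / 2) +
        (volume.restrict (Ω : Set (EuclideanSpace ℝ (Fin N)))) {x | b' ≤ ‖f x - h x‖ₑ} := by
      rw [← ENNReal.ofReal_add ht2.le ht2.le, add_halves]
      exact h1.trans (h4.trans (by gcongr))
    exact (ENNReal.add_le_add_iff_left ENNReal.ofReal_ne_top).1 h6
  have h7 : b' ^ 2 * ENNReal.ofReal (t / 2) ≤ n ^ 2 := le_trans (by gcongr) h3
  have h8 : b' ^ 2 ≤ b ^ 2 := by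
    calc b' ^ 2 = b' ^ 2 * ENNReal.ofReal (t / 2) * ENNReal.ofReal (2 / t) := by
          rw [mul_assoc, ← ENNReal.ofReal_mul ht2.le]
          have : t / 2 * (2 / t) = 1 := by field_simp
          simp [this]
      _ ≤ n ^ 2 * ENNReal.ofReal (2 / t) := by gcongr
      _ = b ^ 2 := by
          rw [hb, mul_pow, ← ENNReal.rpow_natCast (ENNReal.ofReal (2 / t) ^ (1 / 2 : ℝ)),
            ← ENNReal.rpow_mul]
          norm_num
  exact ((ENNReal.pow_lt_pow_left_iff two_ne_zero).2 hbb').not_ge h8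

end Rearrangement

/-! ### The Schur test and a one-sided fundamental theorem of calculus -/

section Schur

variable {α β : Type*} [MeasurableSpace α] [MeasurableSpace β]

theorem sq_lintegral_mul_le {μ : Measure α} {f g : α → ℝ≥0∞} (hf : AEMeasurable f μ)
    (hg : AEMeasurable g μ) :
    (∫⁻ x, f x * g x ∂μ) ^ 2 ≤ (∫⁻ x, f x ^ 2 ∂μ) * ∫⁻ x, g x ^ 2 ∂μ := by
  have h := ENNReal.lintegral_mul_le_Lp_mul_Lq μ Real.HolderConjugate.two_two hf hg
  simp only [Pi.mul_apply, ENNReal.rpow_two] at h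
  calc (∫⁻ x, f x * g x ∂μ) ^ 2 ≤ ((∫⁻ x, f x ^ 2 ∂μ) ^ (1 / 2 : ℝ) *
        (∫⁻ x, g x ^ 2 ∂μ) ^ (1 / 2 : ℝ)) ^ 2 := by gcongr
    _ = _ := by
      rw [mul_pow, ← ENNReal.rpow_two, ← ENNReal.rpow_two, ← ENNReal.rpow_mul, ← ENNReal.rpow_mul]
      norm_num

/-- The Schur test. -/
theorem schur_test {μ : Measure α} [SFinite μ] {ν : Measure β} [SFinite ν]
    {k : β → α → ℝ≥0∞} (hk : Measurable (Function.uncurry k))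
    {p : α → ℝ≥0∞} (hp : Measurable p) (hp0 : ∀ᵐ x ∂μ, p x ≠ 0) (hp1 : ∀ᵐ x ∂μ, p x ≠ ∞)
    {q : β → ℝ≥0∞} (hq : Measurable q) {A B : ℝ≥0∞}
    (hA : ∀ᵐ y ∂ν, ∫⁻ x, k y x * p x ∂μ ≤ A * q y)
    (hB : ∀ᵐ x ∂μ, ∫⁻ y, k y x * q y ∂ν ≤ B * p x)
    {h : α → ℝ≥0∞} (hh : AEMeasurable h μ) :
    ∫⁻ y, (∫⁻ x, k y x * h x ∂μ) ^ 2 ∂ν ≤ A * B * ∫⁻ x, h x ^ 2 ∂μ := by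
  have hred : ∀ y, ∫⁻ x, k y x * h x ∂μ = ∫⁻ x, k y x * hh.mk h x ∂μ := fun y =>
    lintegral_congr_ae (by filter_upwards [hh.ae_eq_mk] with x hx; rw [hx])
  have hred' : ∫⁻ x, h x ^ 2 ∂μ = ∫⁻ x, hh.mk h x ^ 2 ∂μ :=
    lintegral_congr_ae (by filter_upwards [hh.ae_eq_mk] with x hx; rw [hx])
  simp only [hred, hred']
  have hm := hh.measurable_mk
  set g := hh.mk h
  have hky : ∀ y, Measurable (k y) := fun y => hk.comp measurable_prodMk_left
  have hkx : ∀ x, Measurable (fun y => k y x) := fun x => hk.comp measurable_prodMk_right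
  have h1 : ∀ y, (∫⁻ x, k y x * g x ∂μ) ^ 2 ≤
      (∫⁻ x, k y x * p x ∂μ) * ∫⁻ x, k y x * ((p x)⁻¹ * g x ^ 2) ∂μ := by
    intro y
    have hsq : ∀ a : ℝ≥0∞, (a ^ (1 / 2 : ℝ)) ^ 2 = a := fun a => by
      rw [← ENNReal.rpow_two, ← ENNReal.rpow_mul]; norm_num
    have hsq' : ∀ a : ℝ≥0∞, a ^ (1 / 2 : ℝ) * a ^ (1 / 2 : ℝ) = a := fun a => by
      rw [← sq, hsq]
    -- Cauchy–Schwarz for the splitting `k g = (k p)^(1/2) · (k p⁻¹ g²)^(1/2)`; the hypothesis on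
    -- `p` bounds the first factor, and the one on `q` the second after Tonelli.
    have h2 := sq_lintegral_mul_le (μ := μ) (f := fun x => (k y x * p x) ^ (1 / 2 : ℝ))
      (g := fun x => k y x ^ (1 / 2 : ℝ) * ((p x)⁻¹ ^ (1 / 2 : ℝ) * g x))
      (((hky y).mul hp).pow_const _).aemeasurable
      (((hky y).pow_const _).mul ((hp.inv.pow_const _).mul hm)).aemeasurable
    simp only [mul_pow, hsq] at h2
    refine le_trans (le_of_eq ?_) h2
    congr 1
    refine lintegral_congr_ae ?_
    filter_upwards [hp0, hp1] with x h0 h1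
    rw [ENNReal.mul_rpow_of_nonneg _ _ (by norm_num), ENNReal.inv_rpow]
    have h3 : p x ^ (1 / 2 : ℝ) * (p x ^ (1 / 2 : ℝ))⁻¹ = 1 :=
      ENNReal.mul_inv_cancel (by simp [h0, h1]) (by simp [h0, h1])
    calc k y x * g x = (k y x ^ (1 / 2 : ℝ) * k y x ^ (1 / 2 : ℝ)) *
          (p x ^ (1 / 2 : ℝ) * (p x ^ (1 / 2 : ℝ))⁻¹) * g x := by rw [h3, hsq', mul_one]
      _ = _ := by ring
  calc ∫⁻ y, (∫⁻ x, k y x * g x ∂μ) ^ 2 ∂ν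
      ≤ ∫⁻ y, A * (∫⁻ x, q y * (k y x * ((p x)⁻¹ * g x ^ 2)) ∂μ) ∂ν := by
        refine lintegral_mono_ae ?_
        filter_upwards [hA] with y hy
        have hmy : Measurable fun x => k y x * ((p x)⁻¹ * g x ^ 2) :=
          (hky y).mul (hp.inv.mul (hm.pow_const 2))
        rw [lintegral_const_mul _ hmy, ← mul_assoc]
        exact (h1 y).trans (by gcongr)
    _ = A * ∫⁻ y, (∫⁻ x, q y * (k y x * ((p x)⁻¹ * g x ^ 2)) ∂μ) ∂ν := by
        refine lintegral_const_mul _ ?_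
        refine Measurable.lintegral_prod_right ?_
        exact (hq.comp measurable_fst).mul (hk.mul
          ((hp.inv.mul (hm.pow_const 2)).comp measurable_snd))
    _ = A * ∫⁻ x, (∫⁻ y, q y * (k y x * ((p x)⁻¹ * g x ^ 2)) ∂ν) ∂μ := by
        rw [lintegral_lintegral_swap]
        exact ((hq.comp measurable_fst).mul (hk.mul
          ((hp.inv.mul (hm.pow_const 2)).comp measurable_snd))).aemeasurable
    _ ≤ A * ∫⁻ x, B * g x ^ 2 ∂μ := by
        gcongr 1
        refine lintegral_mono_ae ?_
        filter_upwards [hB, hp0, hp1] with x hx h0 h1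
        calc ∫⁻ y, q y * (k y x * ((p x)⁻¹ * g x ^ 2)) ∂ν
            = ∫⁻ y, ((p x)⁻¹ * g x ^ 2) * (k y x * q y) ∂ν :=
              lintegral_congr fun y => by ring
          _ = ((p x)⁻¹ * g x ^ 2) * ∫⁻ y, k y x * q y ∂ν :=
              lintegral_const_mul _ ((hkx x).mul hq)
          _ ≤ ((p x)⁻¹ * g x ^ 2) * (B * p x) := by gcongr
          _ = ((p x)⁻¹ * p x) * (B * g x ^ 2) := by ring
          _ = _ := by rw [ENNReal.inv_mul_cancel h0 h1, one_mul]
    _ = _ := by rw [lintegral_const_mul _ (hm.pow_const 2), mul_assoc]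

end Schur

/-- Exhaust the open interval by compact ones and use monotone convergence. Only bounds on the
primitive inside the interval enter, so powers and logarithms singular at an endpoint need no
limits. -/
theorem lintegral_deriv_le {a b m M : ℝ} {F f : ℝ → ℝ}
    (hF : ∀ x ∈ Set.Ioo a b, HasDerivAt F (f x) x) (hf : ∀ x ∈ Set.Ioo a b, 0 ≤ f x)
    (hm : ∀ x ∈ Set.Ioo a b, m ≤ F x) (hM : ∀ x ∈ Set.Ioo a b, F x ≤ M) :
    ∫⁻ x in Set.Ioo a b, ENNReal.ofReal (f x) ≤ ENNReal.ofReal (M - m) := by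
  rcases le_or_gt b a with hab | hab
  · simp [Set.Ioo_eq_empty_of_le hab]
  -- The shift by `3` keeps both margins at most a third of the length, so `c n ≤ d n` from the
  -- start.
  set c : ℕ → ℝ := fun n => a + (b - a) / (n + 3) with hc
  set d : ℕ → ℝ := fun n => b - (b - a) / (n + 3) with hd
  have hlim : Filter.Tendsto (fun n : ℕ => (b - a) / ((n : ℝ) + 3)) Filter.atTop (nhds 0) :=
    Filter.Tendsto.const_div_atTop
      (Filter.tendsto_atTop_add_const_right _ _ tendsto_natCast_atTop_atTop) _
  have hcover := aecover_Ioo_of_Icc (μ := volume) (l := Filter.atTop) (a := c) (b := d)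
    (A := a) (B := b) (by simpa [hc] using hlim.const_add a) (by simpa [hd] using hlim.const_sub b)
  have hmeas : AEMeasurable (fun x => ENNReal.ofReal (f x)) (volume.restrict (Set.Ioo a b)) := by
    refine ((measurable_deriv F).ennreal_ofReal.aemeasurable).congr ?_
    filter_upwards [ae_restrict_mem measurableSet_Ioo] with x hx
    rw [(hF x hx).deriv]
  refine le_of_tendsto' (hcover.lintegral_tendsto_of_countably_generated hmeas) fun n => ?_
  have hn : 0 < (b - a) / ((n : ℝ) + 3) := div_pos (by linarith) (by positivity)
  have hn' : (b - a) / ((n : ℝ) + 3) ≤ (b - a) / 3 :=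
    div_le_div_of_nonneg_left (by linarith) (by norm_num) (by simp)
  have hcd : c n ≤ d n := by simp only [hc, hd]; linarith
  have hsub : Set.Icc (c n) (d n) ⊆ Set.Ioo a b := fun x hx => by
    simp only [hc, hd, Set.mem_Icc] at hx
    exact ⟨by linarith, by linarith⟩
  rw [Measure.restrict_restrict measurableSet_Icc, Set.inter_eq_left.2 hsub]
  have hcont : ContinuousOn F (Set.Icc (c n) (d n)) := fun x hx =>
    (hF x (hsub hx)).continuousAt.continuousWithinAt
  have hint : IntegrableOn f (Set.Ioc (c n) (d n)) :=
    intervalIntegral.integrableOn_deriv_of_nonneg hcont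
      (fun x hx => hF x (hsub (Set.Ioo_subset_Icc_self hx)))
      (fun x hx => hf x (hsub (Set.Ioo_subset_Icc_self hx)))
  have hFTC := intervalIntegral.integral_eq_sub_of_hasDerivAt_of_le hcd hcont
    (fun x hx => hF x (hsub (Set.Ioo_subset_Icc_self hx)))
    ((intervalIntegrable_iff_integrableOn_Ioc_of_le hcd).2 hint)
  rw [intervalIntegral.integral_of_le hcd] at hFTC
  rw [setLIntegral_congr Ioc_ae_eq_Icc.symm, ← ofReal_integral_eq_lintegral_ofReal hint, hFTC]
  · exact ENNReal.ofReal_le_ofReal (sub_le_sub (hM _ (hsub (Set.right_mem_Icc.2 hcd)))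
      (hm _ (hsub (Set.left_mem_Icc.2 hcd))))
  · filter_upwards [ae_restrict_mem measurableSet_Ioc] with x hx
    exact hf x (hsub (Set.Ioc_subset_Icc_self hx))

/-! ### Hardy inequalities with power and logarithmic weights -/

section Hardy

/-- The Schur test for the kernel `a(t) b(τ)` cut off to `S`, whose sections are `S₁` and `S₂`. The
functions `P` and `Q` bound the section integrals, so each Hardy inequality reduces to two
elementary integrals of real functions. -/
theorem schur_test_separated {V : ℝ} {a b p q : ℝ → ℝ} (ha : Measurable a) (hb : Measurable b)
    (hp : Measurable p) (hq : Measurable q) (ha0 : ∀ t ∈ Set.Ioo 0 V, 0 ≤ a t)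
    (hb0 : ∀ t ∈ Set.Ioo 0 V, 0 ≤ b t)
    (hp0 : ∀ t ∈ Set.Ioo 0 V, 0 < p t)
    {S : Set (ℝ × ℝ)} (hS : MeasurableSet S) {S₁ S₂ : ℝ → Set ℝ}
    (hS₁ : ∀ t ∈ Set.Ioo 0 V, ∀ τ, τ ∈ S₁ t ↔ (t, τ) ∈ S ∧ τ ∈ Set.Ioo 0 V)
    (hS₂ : ∀ τ ∈ Set.Ioo 0 V, ∀ t, t ∈ S₂ τ ↔ (t, τ) ∈ S ∧ t ∈ Set.Ioo 0 V)
    {P Q : ℝ → ℝ} {A B : ℝ} (hA : 0 ≤ A) (hB : 0 ≤ B)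
    (hP : ∀ t ∈ Set.Ioo 0 V, ∫⁻ τ in S₁ t, ENNReal.ofReal (b τ * p τ) ≤ ENNReal.ofReal (P t))
    (hPA : ∀ t ∈ Set.Ioo 0 V, a t * P t ≤ A * q t)
    (hQ : ∀ τ ∈ Set.Ioo 0 V, ∫⁻ t in S₂ τ, ENNReal.ofReal (a t * q t) ≤ ENNReal.ofReal (Q τ))
    (hQB : ∀ τ ∈ Set.Ioo 0 V, b τ * Q τ ≤ B * p τ)
    {h : ℝ → ℝ≥0∞} (hh : AEMeasurable h (volume.restrict (Set.Ioo 0 V))) :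
    ∫⁻ t in Set.Ioo 0 V, (ENNReal.ofReal (a t) * ∫⁻ τ in S₁ t, ENNReal.ofReal (b τ) * h τ) ^ 2 ≤
      ENNReal.ofReal (A * B) * ∫⁻ τ in Set.Ioo 0 V, h τ ^ 2 := by
  classical
  set k : ℝ → ℝ → ℝ≥0∞ := fun t τ =>
    S.indicator (fun z => ENNReal.ofReal (a z.1) * ENNReal.ofReal (b z.2)) (t, τ) with hk
  have hkm : Measurable (Function.uncurry k) := by
    have : Function.uncurry k =
        S.indicator (fun z => ENNReal.ofReal (a z.1) * ENNReal.ofReal (b z.2)) := rfl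
    rw [this]
    exact Measurable.indicator (by fun_prop) hS
  have hm1 : ∀ t, MeasurableSet {τ | (t, τ) ∈ S} := fun t => measurable_prodMk_left hS
  have hm2 : ∀ τ, MeasurableSet {t | (t, τ) ∈ S} := fun t => measurable_prodMk_right hS
  have e1 : ∀ t ∈ Set.Ioo 0 V, ∀ F : ℝ → ℝ≥0∞,
      ∫⁻ τ in Set.Ioo 0 V, k t τ * F τ =
        ENNReal.ofReal (a t) * ∫⁻ τ in S₁ t, ENNReal.ofReal (b τ) * F τ := by
    intro t ht F
    have hSt : S₁ t = {τ | (t, τ) ∈ S} ∩ Set.Ioo 0 V := by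
      ext τ; exact hS₁ t ht τ
    rw [hSt, ← Measure.restrict_restrict (hm1 t), ← lintegral_indicator (hm1 t),
      ← lintegral_const_mul' _ _ ENNReal.ofReal_ne_top]
    refine lintegral_congr fun τ => ?_
    by_cases hτ : (t, τ) ∈ S <;> simp [hk, hτ, mul_assoc]
  have e2 : ∀ τ ∈ Set.Ioo 0 V, ∀ F : ℝ → ℝ≥0∞,
      ∫⁻ t in Set.Ioo 0 V, k t τ * F t =
        ENNReal.ofReal (b τ) * ∫⁻ t in S₂ τ, ENNReal.ofReal (a t) * F t := by
    intro τ hτ F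
    have hSt : S₂ τ = {t | (t, τ) ∈ S} ∩ Set.Ioo 0 V := by
      ext t; exact hS₂ τ hτ t
    rw [hSt, ← Measure.restrict_restrict (hm2 τ), ← lintegral_indicator (hm2 τ),
      ← lintegral_const_mul' _ _ ENNReal.ofReal_ne_top]
    refine lintegral_congr fun t => ?_
    by_cases hτ : (t, τ) ∈ S
    · simp only [hk, Set.indicator, hτ, Set.mem_ofPred_eq, if_true]
      ring
    · simp [hk, hτ]
  have hsub1 : ∀ t ∈ Set.Ioo 0 V, MeasurableSet (S₁ t) := fun t ht => by
    have hSt : S₁ t = {τ | (t, τ) ∈ S} ∩ Set.Ioo 0 V := by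
      ext τ; exact hS₁ t ht τ
    rw [hSt]; exact (hm1 t).inter measurableSet_Ioo
  have hsub2 : ∀ t ∈ Set.Ioo 0 V, MeasurableSet (S₂ t) := fun τ hτ => by
    have hSt : S₂ τ = {t | (t, τ) ∈ S} ∩ Set.Ioo 0 V := by
      ext t; exact hS₂ τ hτ t
    rw [hSt]; exact (hm2 τ).inter measurableSet_Ioo
  have hschur := schur_test (μ := volume.restrict (Set.Ioo 0 V))
    (ν := volume.restrict (Set.Ioo 0 V)) hkm (p := fun τ => ENNReal.ofReal (p τ))
    (q := fun t => ENNReal.ofReal (q t)) hp.ennreal_ofReal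
    (by filter_upwards [ae_restrict_mem measurableSet_Ioo] with τ hτ using by simpa using hp0 τ hτ)
    (by simp) hq.ennreal_ofReal (A := ENNReal.ofReal A) (B := ENNReal.ofReal B)
    (by
      filter_upwards [ae_restrict_mem measurableSet_Ioo] with t ht
      rw [e1 t ht, ← ENNReal.ofReal_mul hA]
      refine le_trans ?_ (ENNReal.ofReal_le_ofReal (hPA t ht))
      rw [ENNReal.ofReal_mul (ha0 t ht)]
      gcongr
      refine le_trans (le_of_eq ?_) (hP t ht)
      refine setLIntegral_congr_fun (hsub1 t ht) fun τ hτ => ?_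
      exact (ENNReal.ofReal_mul (hb0 τ ((hS₁ t ht τ).1 hτ).2)).symm)
    (by
      filter_upwards [ae_restrict_mem measurableSet_Ioo] with τ hτ
      rw [e2 τ hτ, ← ENNReal.ofReal_mul hB]
      refine le_trans ?_ (ENNReal.ofReal_le_ofReal (hQB τ hτ))
      rw [ENNReal.ofReal_mul (hb0 τ hτ)]
      gcongr
      refine le_trans (le_of_eq ?_) (hQ τ hτ)
      refine setLIntegral_congr_fun (hsub2 τ hτ) fun t ht => ?_
      exact (ENNReal.ofReal_mul (ha0 t ((hS₂ τ hτ t).1 ht).2)).symm) hh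
  rw [ENNReal.ofReal_mul hA]
  refine le_trans (le_of_eq ?_) hschur
  exact setLIntegral_congr_fun measurableSet_Ioo fun t ht => by
    change _ = (∫⁻ τ in Set.Ioo 0 V, k t τ * h τ) ^ 2
    rw [e1 t ht]

theorem lintegral_Ioo_rpow_le {r t c : ℝ} (hr : 0 < r + 1) (hc : 0 ≤ c) :
    ∫⁻ τ in Set.Ioo 0 t, ENNReal.ofReal (c * τ ^ r) ≤
      ENNReal.ofReal (c * (t ^ (r + 1) / (r + 1))) := by
  have h := lintegral_deriv_le (a := 0) (b := t) (m := 0) (M := c * (t ^ (r + 1) / (r + 1)))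
    (F := fun x => c * (x ^ (r + 1) / (r + 1))) (f := fun x => c * x ^ r)
    (fun x hx => by
      have h1 := ((Real.hasDerivAt_rpow_const (p := r + 1) (Or.inl hx.1.ne')).div_const
        (r + 1)).const_mul c
      refine h1.congr_deriv ?_
      rw [add_sub_cancel_right]
      field_simp)
    (fun x hx => mul_nonneg hc (Real.rpow_nonneg hx.1.le _))
    (fun x hx => mul_nonneg hc (div_nonneg (Real.rpow_nonneg hx.1.le _) hr.le))
    (fun x hx => by
      have := Real.rpow_le_rpow hx.1.le hx.2.le hr.le
      gcongr)
  simpa using h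

theorem lintegral_Ioo_rpow_le_of_neg {r t V c : ℝ} (hr : r + 1 < 0) (ht : 0 < t) (hc : 0 ≤ c) :
    ∫⁻ τ in Set.Ioo t V, ENNReal.ofReal (c * τ ^ r) ≤
      ENNReal.ofReal (c * (t ^ (r + 1) / (-(r + 1)))) := by
  have h := lintegral_deriv_le (a := t) (b := V) (m := -(c * (t ^ (r + 1) / (-(r + 1))))) (M := 0)
    (F := fun x => c * (x ^ (r + 1) / (r + 1))) (f := fun x => c * x ^ r)
    (fun x hx => by
      have hx0 : 0 < x := ht.trans hx.1
      have h1 := ((Real.hasDerivAt_rpow_const (p := r + 1) (Or.inl hx0.ne')).div_const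
        (r + 1)).const_mul c
      refine h1.congr_deriv ?_
      rw [add_sub_cancel_right]
      have := hr.ne
      field_simp)
    (fun x hx => mul_nonneg hc (Real.rpow_nonneg (ht.trans hx.1).le _))
    (fun x hx => by
      have := Real.rpow_le_rpow_of_nonpos ht hx.1.le hr.le
      rw [div_neg, mul_neg, neg_neg]
      refine mul_le_mul_of_nonneg_left ?_ hc
      exact div_le_div_of_nonpos_of_le hr.le this)
    (fun x hx => mul_nonpos_of_nonneg_of_nonpos hc
      (div_nonpos_of_nonneg_of_nonpos (Real.rpow_nonneg (ht.trans hx.1).le _) hr.le))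
  simpa using h

theorem measurableSet_setOf_snd_lt_fst : MeasurableSet {z : ℝ × ℝ | z.2 < z.1} :=
  measurableSet_lt measurable_snd measurable_fst

/-- Hardy's inequality for averages. -/
theorem hardy_average {V : ℝ} {h : ℝ → ℝ≥0∞}
    (hh : AEMeasurable h (volume.restrict (Set.Ioo 0 V))) :
    ∫⁻ t in Set.Ioo 0 V, (ENNReal.ofReal t⁻¹ * ∫⁻ τ in Set.Ioo 0 t, h τ) ^ 2 ≤
      4 * ∫⁻ τ in Set.Ioo 0 V, h τ ^ 2 := by
  have hpow : ∀ t : ℝ, 0 < t → t⁻¹ * t ^ (1 / 2 : ℝ) = t ^ (-(1 / 2) : ℝ) := fun t ht => by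
    rw [← Real.rpow_neg_one, ← Real.rpow_add ht]; norm_num
  have hpow' : ∀ t : ℝ, 0 < t → t⁻¹ * t ^ (-(1 / 2) : ℝ) = t ^ (-(3 / 2) : ℝ) := fun t ht => by
    rw [← Real.rpow_neg_one, ← Real.rpow_add ht]; norm_num
  -- The test function `t^(-1/2)` has the critical homogeneity of `L²`; both section integrals give
  -- the factor `2`, hence the constant `4`.
  have h1 := schur_test_separated (V := V) (a := fun t => t⁻¹) (b := fun _ => 1)
    (p := fun t => t ^ (-(1 / 2) : ℝ)) (q := fun t => t ^ (-(1 / 2) : ℝ))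
    (by fun_prop) (by fun_prop) (by fun_prop) (by fun_prop)
    (fun t ht => (inv_pos.2 ht.1).le) (fun t ht => zero_le_one)
    (fun t ht => Real.rpow_pos_of_pos ht.1 _) measurableSet_setOf_snd_lt_fst
    (S₁ := fun t => Set.Ioo 0 t) (S₂ := fun τ => Set.Ioo τ V)
    (fun t ht τ => ⟨fun hτ => ⟨hτ.2, hτ.1, hτ.2.trans ht.2⟩, fun hτ => ⟨hτ.2.1, hτ.1⟩⟩)
    (fun τ hτ t => ⟨fun ht => ⟨ht.1, hτ.1.trans ht.1, ht.2⟩, fun ht => ⟨ht.1, ht.2.2⟩⟩)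
    (P := fun t => 2 * t ^ (1 / 2 : ℝ)) (Q := fun t => 2 * t ^ (-(1 / 2) : ℝ))
    (A := 2) (B := 2) (by norm_num) (by norm_num)
    (fun t ht => by
      refine (lintegral_Ioo_rpow_le (by norm_num) zero_le_one).trans (le_of_eq ?_)
      congr 1
      norm_num
      ring)
    (fun t ht => le_of_eq (by rw [← hpow t ht.1]; ring))
    (fun τ hτ => by
      calc ∫⁻ t in Set.Ioo τ V, ENNReal.ofReal (t⁻¹ * t ^ (-(1 / 2) : ℝ))
          = ∫⁻ t in Set.Ioo τ V, ENNReal.ofReal (1 * t ^ (-(3 / 2) : ℝ)) :=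
            setLIntegral_congr_fun measurableSet_Ioo fun t ht => by
              rw [hpow' t (hτ.1.trans ht.1), one_mul]
        _ ≤ _ := (lintegral_Ioo_rpow_le_of_neg (by norm_num) hτ.1 zero_le_one)
        _ = _ := by congr 1; norm_num; ring)
    (fun t ht => by simp) hh
  norm_num at h1
  simpa using h1

/-- The logarithm `log (e V / t)`. -/
noncomputable def logTerm (V t : ℝ) : ℝ := Real.log (Real.exp 1 * V / t)

theorem measurable_logTerm (V : ℝ) : Measurable (logTerm V) := by
  unfold logTerm; fun_prop

theorem logTerm_eq {V t : ℝ} (hV : 0 < V) (ht : 0 < t) :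
    logTerm V t = 1 + Real.log V - Real.log t := by
  rw [logTerm, Real.log_div (by positivity) ht.ne', Real.log_mul (Real.exp_ne_zero _) hV.ne',
    Real.log_exp]

theorem one_le_logTerm {V t : ℝ} (ht : t ∈ Set.Ioo 0 V) : 1 ≤ logTerm V t := by
  rw [logTerm_eq (ht.1.trans ht.2) ht.1]
  have := Real.log_le_log ht.1 ht.2.le
  linarith

theorem logTerm_pos {V t : ℝ} (ht : t ∈ Set.Ioo 0 V) : 0 < logTerm V t :=
  zero_lt_one.trans_le (one_le_logTerm ht)

theorem hasDerivAt_logTerm {V t : ℝ} (ht : t ∈ Set.Ioo 0 V) :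
    HasDerivAt (logTerm V) (-t⁻¹) t := by
  have h1 : HasDerivAt (fun t => 1 + Real.log V - Real.log t) (-t⁻¹) t :=
    (Real.hasDerivAt_log ht.1.ne').const_sub _
  refine h1.congr_of_eventuallyEq ?_
  filter_upwards [lt_mem_nhds ht.1] with s hs
  exact logTerm_eq (ht.1.trans ht.2) hs

theorem hasDerivAt_logTerm_rpow {V t r : ℝ} (ht : t ∈ Set.Ioo 0 V) :
    HasDerivAt (fun t => logTerm V t ^ r) (-t⁻¹ * r * logTerm V t ^ (r - 1)) t :=
  (hasDerivAt_logTerm ht).rpow_const (Or.inl (logTerm_pos ht).ne')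

theorem logTerm_anti {V s t : ℝ} (hs : 0 < s) (hst : s ≤ t) (ht : t < V) :
    logTerm V t ≤ logTerm V s := by
  rw [logTerm_eq (by linarith) (by linarith), logTerm_eq (by linarith) (by linarith)]
  have := Real.log_le_log hs hst
  linarith

/-- The logarithms differ by `log (t/s) ≤ 4 (t/s)^(1/4)`, and both `(t/s)^(1/4)` and `logTerm V t`
are at least one, whence `5 = 1 + 4`. A logarithmic weight can thus be moved between two points at
the cost of a small power. -/
theorem logTerm_le_mul {V s t : ℝ} (hs : 0 < s) (hst : s ≤ t) (ht : t < V) :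
    logTerm V s ≤ 5 * (t / s) ^ (1 / 4 : ℝ) * logTerm V t := by
  have ht0 : 0 < t := hs.trans_le hst
  have h1 : logTerm V s = logTerm V t + Real.log (t / s) := by
    rw [logTerm_eq (by linarith) hs, logTerm_eq (by linarith) ht0, Real.log_div ht0.ne' hs.ne']
    ring
  have h2 := one_le_logTerm (V := V) ⟨ht0, ht⟩
  have hx : 1 ≤ t / s := (one_le_div hs).2 hst
  have h3 : Real.log (t / s) ≤ (t / s) ^ (1 / 4 : ℝ) / (1 / 4) :=
    Real.log_le_rpow_div (by positivity) (by norm_num)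
  have h4 : 1 ≤ (t / s) ^ (1 / 4 : ℝ) := Real.one_le_rpow hx (by norm_num)
  rw [h1]
  nlinarith [mul_nonneg (sub_nonneg.2 h4) (sub_nonneg.2 h2)]

/-- Hardy's inequality for tails, with a logarithmic weight. -/
theorem hardy_log {V : ℝ} {h : ℝ → ℝ≥0∞}
    (hh : AEMeasurable h (volume.restrict (Set.Ioo 0 V))) :
    ∫⁻ t in Set.Ioo 0 V, (ENNReal.ofReal (t ^ (-(1 / 2) : ℝ) * (logTerm V t)⁻¹) *
      ∫⁻ τ in Set.Ioo t V, ENNReal.ofReal (τ ^ (-(1 / 2) : ℝ)) * h τ) ^ 2 ≤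
      4 * ∫⁻ τ in Set.Ioo 0 V, h τ ^ 2 := by
  have hpow : ∀ t : ℝ, 0 < t → t ^ (-(1 / 2) : ℝ) * t ^ (-(1 / 2) : ℝ) = t⁻¹ := fun t ht => by
    rw [← Real.rpow_neg_one, ← Real.rpow_add ht]; norm_num
  have hmeas := measurable_logTerm V
  -- Put `ℓ = logTerm V`. The test function `t^(-1/2) ℓ^(-1/2)` leaves the integrals of `τ⁻¹
  -- ℓ^(-1/2)` over `(t, V)` and of `t⁻¹ ℓ^(-3/2)` over `(0, τ)`, with primitives `-2 ℓ^(1/2)` and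
  -- `2 ℓ^(-1/2)`. The inverse logarithm in the weight makes the second converge at `0`.
  have h1 := schur_test_separated (V := V) (a := fun t => t ^ (-(1 / 2) : ℝ) * (logTerm V t)⁻¹)
    (b := fun t => t ^ (-(1 / 2) : ℝ))
    (p := fun t => t ^ (-(1 / 2) : ℝ) * logTerm V t ^ (-(1 / 2) : ℝ))
    (q := fun t => t ^ (-(1 / 2) : ℝ) * logTerm V t ^ (-(1 / 2) : ℝ))
    (by fun_prop) (by fun_prop) (by fun_prop) (by fun_prop)
    (fun t ht => mul_nonneg (Real.rpow_nonneg ht.1.le _) (inv_nonneg.2 (logTerm_pos ht).le))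
    (fun t ht => Real.rpow_nonneg ht.1.le _)
    (fun t ht => mul_pos (Real.rpow_pos_of_pos ht.1 _) (Real.rpow_pos_of_pos (logTerm_pos ht) _))
    (S := {z | z.1 < z.2}) (measurableSet_lt measurable_fst measurable_snd)
    (S₁ := fun t => Set.Ioo t V) (S₂ := fun τ => Set.Ioo 0 τ)
    (fun t ht τ => ⟨fun hτ => ⟨hτ.1, ht.1.trans hτ.1, hτ.2⟩, fun hτ => ⟨hτ.1, hτ.2.2⟩⟩)
    (fun τ hτ t => ⟨fun ht => ⟨ht.2, ht.1, ht.2.trans hτ.2⟩, fun ht => ⟨ht.2.1, ht.1⟩⟩)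
    (P := fun t => 2 * logTerm V t ^ (1 / 2 : ℝ)) (Q := fun t => 2 * logTerm V t ^ (-(1 / 2) : ℝ))
    (A := 2) (B := 2) (by norm_num) (by norm_num)
    (fun t ht => by
      have h2 := lintegral_deriv_le (a := t) (b := V) (m := -(2 * logTerm V t ^ (1 / 2 : ℝ)))
        (M := 0) (F := fun τ => -2 * logTerm V τ ^ (1 / 2 : ℝ))
        (f := fun τ => τ⁻¹ * logTerm V τ ^ (-(1 / 2) : ℝ))
        (fun τ hτ => by
          refine ((hasDerivAt_logTerm_rpow (r := 1 / 2)
            ⟨ht.1.trans hτ.1, hτ.2⟩).const_mul (-2)).congr_deriv ?_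
          norm_num
          ring)
        (fun τ hτ => mul_nonneg (inv_nonneg.2 (ht.1.trans hτ.1).le)
          (Real.rpow_nonneg (logTerm_pos ⟨ht.1.trans hτ.1, hτ.2⟩).le _))
        (fun τ hτ => by
          have := Real.rpow_le_rpow (logTerm_pos ⟨ht.1.trans hτ.1, hτ.2⟩).le
            (logTerm_anti ht.1 hτ.1.le hτ.2) (z := 1 / 2) (by norm_num)
          linarith)
        (fun τ hτ => by
          have := Real.rpow_nonneg (logTerm_pos ⟨ht.1.trans hτ.1, hτ.2⟩).le (1 / 2)
          linarith)
      rw [zero_sub, neg_neg] at h2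
      refine le_trans (le_of_eq ?_) h2
      refine setLIntegral_congr_fun measurableSet_Ioo fun τ hτ => ?_
      rw [← mul_assoc, hpow τ (ht.1.trans hτ.1)])
    (fun t ht => le_of_eq (by
      have hl : logTerm V t ^ (-(1 / 2) : ℝ) = (logTerm V t)⁻¹ * logTerm V t ^ (1 / 2 : ℝ) := by
        rw [← Real.rpow_neg_one, ← Real.rpow_add (logTerm_pos ht)]; norm_num
      rw [hl]; ring))
    (fun τ hτ => by
      have hτ' : ∀ t ∈ Set.Ioo 0 τ, t ∈ Set.Ioo 0 V := fun t ht => ⟨ht.1, ht.2.trans hτ.2⟩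
      have h2 := lintegral_deriv_le (a := 0) (b := τ) (m := 0)
        (M := 2 * logTerm V τ ^ (-(1 / 2) : ℝ)) (F := fun t => 2 * logTerm V t ^ (-(1 / 2) : ℝ))
        (f := fun t => t⁻¹ * logTerm V t ^ (-(3 / 2) : ℝ))
        (fun t ht => by
          refine ((hasDerivAt_logTerm_rpow (r := -(1 / 2)) (hτ' t ht)).const_mul 2).congr_deriv ?_
          norm_num
          ring)
        (fun t ht => mul_nonneg (inv_nonneg.2 ht.1.le)
          (Real.rpow_nonneg (logTerm_pos (hτ' t ht)).le _))
        (fun t ht => mul_nonneg zero_le_two (Real.rpow_nonneg (logTerm_pos (hτ' t ht)).le _))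
        (fun t ht => by
          have := Real.rpow_le_rpow_of_nonpos (logTerm_pos hτ)
            (logTerm_anti ht.1 ht.2.le hτ.2) (z := -(1 / 2)) (by norm_num)
          linarith)
      rw [sub_zero] at h2
      refine le_trans (le_of_eq ?_) h2
      refine setLIntegral_congr_fun measurableSet_Ioo fun t ht => ?_
      have hl : logTerm V t ^ (-(3 / 2) : ℝ) =
          (logTerm V t)⁻¹ * logTerm V t ^ (-(1 / 2) : ℝ) := by
        rw [← Real.rpow_neg_one, ← Real.rpow_add (logTerm_pos (hτ' t ht))]; norm_num
      rw [hl, ← hpow t ht.1]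
      congr 1
      ring)
    (fun t ht => le_of_eq (by ring)) hh
  norm_num at h1
  simpa using h1

/-- Hardy's inequality for averages, with a logarithmic weight. -/
theorem hardy_average_log {V : ℝ} {h : ℝ → ℝ≥0∞}
    (hh : AEMeasurable h (volume.restrict (Set.Ioo 0 V))) :
    ∫⁻ t in Set.Ioo 0 V, (ENNReal.ofReal (t ^ (-(1 / 2) : ℝ) * (logTerm V t)⁻¹) *
      (ENNReal.ofReal t⁻¹ * ∫⁻ τ in Set.Ioo 0 t, h τ)) ^ 2 ≤
      ENNReal.ofReal 49 * ∫⁻ τ in Set.Ioo 0 V,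
        (ENNReal.ofReal (τ ^ (-(1 / 2) : ℝ) * (logTerm V τ)⁻¹) * h τ) ^ 2 := by
  have hmeas := measurable_logTerm V
  set H : ℝ → ℝ≥0∞ := fun τ => ENNReal.ofReal (τ ^ (-(1 / 2) : ℝ) * (logTerm V τ)⁻¹) * h τ with hH
  have hHm : AEMeasurable H (volume.restrict (Set.Ioo 0 V)) := AEMeasurable.mul (by fun_prop) hh
  have hpow : ∀ (t r s : ℝ), 0 < t → t ^ r * t ^ s = t ^ (r + s) := fun t r s ht =>
    (Real.rpow_add ht r s).symm
  -- After `logTerm_le_mul` the kernel acting on the weighted function `H` is at most `5 t^(-5/4)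
  -- τ^(1/4)`, a pure power. Both Schur constants are `5 · 4/3 = 20/3`, rounded up to `7`.
  have h1 := schur_test_separated (V := V) (a := fun t => 5 * t ^ (-(5 / 4) : ℝ))
    (b := fun t => t ^ (1 / 4 : ℝ))
    (p := fun t => t ^ (-(1 / 2) : ℝ)) (q := fun t => t ^ (-(1 / 2) : ℝ))
    (by fun_prop) (by fun_prop) (by fun_prop) (by fun_prop)
    (fun t ht => mul_nonneg (by norm_num) (Real.rpow_nonneg ht.1.le _))
    (fun t ht => Real.rpow_nonneg ht.1.le _)
    (fun t ht => Real.rpow_pos_of_pos ht.1 _) measurableSet_setOf_snd_lt_fst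
    (S₁ := fun t => Set.Ioo 0 t) (S₂ := fun τ => Set.Ioo τ V)
    (fun t ht τ => ⟨fun hτ => ⟨hτ.2, hτ.1, hτ.2.trans ht.2⟩, fun hτ => ⟨hτ.2.1, hτ.1⟩⟩)
    (fun τ hτ t => ⟨fun ht => ⟨ht.1, hτ.1.trans ht.1, ht.2⟩, fun ht => ⟨ht.1, ht.2.2⟩⟩)
    (P := fun t => 4 / 3 * t ^ (3 / 4 : ℝ)) (Q := fun t => 5 * (4 / 3 * t ^ (-(3 / 4) : ℝ)))
    (A := 7) (B := 7) (by norm_num) (by norm_num)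
    (fun t ht => by
      calc ∫⁻ τ in Set.Ioo 0 t, ENNReal.ofReal (τ ^ (1 / 4 : ℝ) * τ ^ (-(1 / 2) : ℝ))
          = ∫⁻ τ in Set.Ioo 0 t, ENNReal.ofReal (1 * τ ^ (-(1 / 4) : ℝ)) :=
            setLIntegral_congr_fun measurableSet_Ioo fun τ hτ => by
              rw [hpow _ _ _ hτ.1, one_mul]; norm_num
        _ ≤ _ := (lintegral_Ioo_rpow_le (by norm_num) zero_le_one)
        _ = _ := by congr 1; norm_num; ring)
    (fun t ht => by
      have h2 : t ^ (-(5 / 4) : ℝ) * t ^ (3 / 4 : ℝ) = t ^ (-(1 / 2) : ℝ) := by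
        rw [hpow _ _ _ ht.1]; norm_num
      have h3 := Real.rpow_nonneg ht.1.le (-(1 / 2) : ℝ)
      nlinarith)
    (fun τ hτ => by
      calc ∫⁻ t in Set.Ioo τ V, ENNReal.ofReal (5 * t ^ (-(5 / 4) : ℝ) * t ^ (-(1 / 2) : ℝ))
          = ∫⁻ t in Set.Ioo τ V, ENNReal.ofReal (5 * t ^ (-(7 / 4) : ℝ)) :=
            setLIntegral_congr_fun measurableSet_Ioo fun t ht => by
              rw [mul_assoc, hpow _ _ _ (hτ.1.trans ht.1)]; norm_num
        _ ≤ _ := (lintegral_Ioo_rpow_le_of_neg (by norm_num) hτ.1 (by norm_num))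
        _ = _ := by congr 1; norm_num; ring)
    (fun t ht => by
      have h2 : t ^ (1 / 4 : ℝ) * t ^ (-(3 / 4) : ℝ) = t ^ (-(1 / 2) : ℝ) := by
        rw [hpow _ _ _ ht.1]; norm_num
      have h3 := Real.rpow_nonneg ht.1.le (-(1 / 2) : ℝ)
      nlinarith) hHm
  rw [show (7 * 7 : ℝ) = 49 by norm_num] at h1
  refine le_trans ?_ h1
  refine setLIntegral_mono' measurableSet_Ioo fun t ht => ?_
  gcongr ?_ ^ 2
  rw [← mul_assoc, ← lintegral_const_mul' _ _ (by finiteness),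
    ← lintegral_const_mul' _ _ (by finiteness)]
  refine setLIntegral_mono' measurableSet_Ioo fun τ hτ => ?_
  have hτV : τ ∈ Set.Ioo 0 V := ⟨hτ.1, hτ.2.trans ht.2⟩
  have hlt := logTerm_pos ht
  have hlτ := logTerm_pos hτV
  have hle := logTerm_le_mul hτ.1 hτ.2.le ht.2
  rw [Real.div_rpow ht.1.le hτ.1.le] at hle
  have e1 : t ^ (-(1 / 2) : ℝ) * t⁻¹ * t ^ (1 / 4 : ℝ) = t ^ (-(5 / 4) : ℝ) := by
    rw [← Real.rpow_neg_one, hpow _ _ _ ht.1, hpow _ _ _ ht.1]; norm_num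
  have e2 : (τ ^ (1 / 4 : ℝ))⁻¹ = τ ^ (1 / 4 : ℝ) * τ ^ (-(1 / 2) : ℝ) := by
    rw [← Real.rpow_neg hτ.1.le, hpow _ _ _ hτ.1]; norm_num
  have hkey : t ^ (-(1 / 2) : ℝ) * (logTerm V t)⁻¹ * t⁻¹ ≤
      5 * t ^ (-(5 / 4) : ℝ) * (τ ^ (1 / 4 : ℝ) * (τ ^ (-(1 / 2) : ℝ) * (logTerm V τ)⁻¹)) := by
    have ht1 := Real.rpow_nonneg ht.1.le (-(1 / 2) : ℝ)
    have ht2 : 0 ≤ t⁻¹ := (inv_pos.2 ht.1).le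
    calc t ^ (-(1 / 2) : ℝ) * (logTerm V t)⁻¹ * t⁻¹
        = t ^ (-(1 / 2) : ℝ) * t⁻¹ * (logTerm V t)⁻¹ * (logTerm V τ)⁻¹ * logTerm V τ := by
          field_simp
      _ ≤ t ^ (-(1 / 2) : ℝ) * t⁻¹ * (logTerm V t)⁻¹ * (logTerm V τ)⁻¹ *
          (5 * (t ^ (1 / 4 : ℝ) / τ ^ (1 / 4 : ℝ)) * logTerm V t) := by
          gcongr
      _ = 5 * (t ^ (-(1 / 2) : ℝ) * t⁻¹ * t ^ (1 / 4 : ℝ)) *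
          ((τ ^ (1 / 4 : ℝ))⁻¹ * (logTerm V τ)⁻¹) := by
          field_simp
      _ = _ := by rw [e1, e2]; ring
  calc _ ≤ ENNReal.ofReal (5 * t ^ (-(5 / 4) : ℝ) *
          (τ ^ (1 / 4 : ℝ) * (τ ^ (-(1 / 2) : ℝ) * (logTerm V τ)⁻¹))) * h τ := by
        rw [← ENNReal.ofReal_mul
          (mul_nonneg (Real.rpow_nonneg ht.1.le _) (inv_nonneg.2 hlt.le))]
        gcongr
    _ = _ := by
        rw [ENNReal.ofReal_mul (mul_nonneg (by norm_num) (Real.rpow_nonneg ht.1.le _)),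
          ENNReal.ofReal_mul (Real.rpow_nonneg hτ.1.le _), hH]
        ring

end Hardy

/-! ### Rearrangement estimate for potentials of order two on `ℝ⁴` -/

section Potential

/-- The volume of the unit ball of `ℝ⁴`. -/
noncomputable def ballVol : ℝ := (volume (Metric.ball (0 : EuclideanSpace ℝ (Fin 4)) 1)).toReal

theorem ballVol_pos : 0 < ballVol :=
  ENNReal.toReal_pos (Metric.measure_ball_pos volume _ one_pos).ne' measure_ball_lt_top.ne

theorem ofReal_ballVol : ENNReal.ofReal ballVol =
    volume (Metric.ball (0 : EuclideanSpace ℝ (Fin 4)) 1) :=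
  ENNReal.ofReal_toReal measure_ball_lt_top.ne

theorem volume_ball_eq (x : EuclideanSpace ℝ (Fin 4)) {r : ℝ} (hr : 0 ≤ r) :
    volume (Metric.ball x r) = ENNReal.ofReal (ballVol * r ^ 4) := by
  rw [Measure.addHaar_ball volume x hr, ← ofReal_ballVol, mul_comm,
    ← ENNReal.ofReal_mul ballVol_pos.le]
  simp

theorem lintegral_Ioi_rpow_neg_three {ρ : ℝ} (hρ : 0 < ρ) :
    ∫⁻ r in Set.Ioi ρ, ENNReal.ofReal (r ^ (-3 : ℝ)) = ENNReal.ofReal (ρ ^ (-2 : ℝ) / 2) := by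
  rw [← ofReal_integral_eq_lintegral_ofReal (integrableOn_Ioi_rpow_of_lt (by norm_num) hρ),
    integral_Ioi_rpow_of_lt (by norm_num) hρ]
  · congr 1
    norm_num
  · filter_upwards [ae_restrict_mem measurableSet_Ioi] with r hr
    exact Real.rpow_nonneg (hρ.trans hr).le _

variable {Ω : Opens (EuclideanSpace ℝ (Fin 4))} {f g : EuclideanSpace ℝ (Fin 4) → ℝ}

theorem lintegral_sub_eq_setLIntegral (hg0 : ∀ x ∉ Ω, g x = 0) (l : ℝ≥0∞) :
    ∫⁻ x, (‖g x‖ₑ - l) = ∫⁻ x in (Ω : Set (EuclideanSpace ℝ (Fin 4))), (‖g x‖ₑ - l) := by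
  rw [← lintegral_indicator Ω.isOpen.measurableSet]
  refine lintegral_congr fun x => ?_
  by_cases hx : x ∈ (Ω : Set (EuclideanSpace ℝ (Fin 4)))
  · rw [Set.indicator_of_mem hx]
  · rw [Set.indicator_of_notMem hx, hg0 x hx]; simp

/-- Truncation at a free level: the excess over `l` is treated in `L¹`, the rest in `L^∞`. Later `l`
is a value of `g*`. -/
theorem lintegral_ball_le (hg : Measurable g) (l : ℝ≥0∞) (x : EuclideanSpace ℝ (Fin 4)) {r : ℝ}
    (hr : 0 ≤ r) : ∫⁻ y in Metric.ball x r, ‖g y‖ₑ ≤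
      (∫⁻ y in Metric.ball x r, (‖g y‖ₑ - l)) + l * ENNReal.ofReal (ballVol * r ^ 4) := by
  calc ∫⁻ y in Metric.ball x r, ‖g y‖ₑ ≤ ∫⁻ y in Metric.ball x r, ((‖g y‖ₑ - l) + l) :=
        lintegral_mono fun y => le_tsub_add
    _ = _ := by
        rw [lintegral_add_left (hg.enorm.sub_const _), lintegral_const,
          Measure.restrict_apply_univ, volume_ball_eq x hr]

theorem lintegral_ball_le_rearr (hg : Measurable g) (hg0 : ∀ x ∉ Ω, g x = 0)
    (x : EuclideanSpace ℝ (Fin 4)) {r : ℝ} (hr : 0 < r) :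
    ∫⁻ y in Metric.ball x r, ‖g y‖ₑ ≤ ∫⁻ τ in Set.Ioo 0 (ballVol * r ^ 4), rearr Ω g τ := by
  have ht : 0 < ballVol * r ^ 4 := mul_pos ballVol_pos (by positivity)
  refine (lintegral_ball_le hg (rearr Ω g (ballVol * r ^ 4)) x hr.le).trans ?_
  refine le_trans ?_ (lintegral_sub_rearr_add_le hg.aemeasurable ht)
  rw [← lintegral_sub_eq_setLIntegral hg0]
  gcongr
  exact Measure.restrict_le_self

/-- The far part is bounded uniformly in `x`: the integral of `|g|` over a ball is at most that of
`g*` up to the volume of the ball, and exchanging the order of integration leaves `∫ r⁻³` over the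
admissible radii. The lower limit is the radius of the ball of volume `t`. -/
theorem lintegral_tail_le (hg : Measurable g) (hg0 : ∀ x ∉ Ω, g x = 0)
    (x : EuclideanSpace ℝ (Fin 4)) {t : ℝ} (ht : 0 < t) :
    ∫⁻ r in Set.Ioi ((t / ballVol) ^ (1 / 4 : ℝ)),
        ENNReal.ofReal (r ^ (-3 : ℝ)) * ∫⁻ y in Metric.ball x r, ‖g y‖ₑ ≤
      ENNReal.ofReal (ballVol ^ (1 / 2 : ℝ) / 2) *
        (ENNReal.ofReal (t ^ (-(1 / 2) : ℝ)) * (∫⁻ τ in Set.Ioo 0 t, rearr Ω g τ) +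
          ∫⁻ τ in Set.Ioi t, ENNReal.ofReal (τ ^ (-(1 / 2) : ℝ)) * rearr Ω g τ) := by
  have hω := ballVol_pos
  set R := (t / ballVol) ^ (1 / 4 : ℝ) with hR
  have hRpos : 0 < R := Real.rpow_pos_of_pos (div_pos ht hω) _
  have hval : ∀ τ : ℝ, 0 < τ → ((τ / ballVol) ^ (1 / 4 : ℝ)) ^ (-2 : ℝ) / 2 =
      ballVol ^ (1 / 2 : ℝ) / 2 * τ ^ (-(1 / 2) : ℝ) := by
    intro τ hτ
    rw [← Real.rpow_mul (div_pos hτ hω).le, Real.div_rpow hτ.le hω.le, div_eq_mul_inv (τ ^ _),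
      ← Real.rpow_neg hω.le]
    norm_num
    ring
  have hlt : ∀ τ r : ℝ, 0 < τ → 0 < r → τ < ballVol * r ^ 4 → (τ / ballVol) ^ (1 / 4 : ℝ) < r := by
    intro τ r hτ hr h
    have h1 : τ / ballVol < r ^ 4 := by rwa [div_lt_iff₀' hω]
    calc (τ / ballVol) ^ (1 / 4 : ℝ) < (r ^ 4) ^ (1 / 4 : ℝ) :=
          Real.rpow_lt_rpow (div_pos hτ hω).le h1 (by norm_num)
      _ = r := by
          rw [← Real.rpow_natCast, ← Real.rpow_mul hr.le]; norm_num
  have hinner : ∀ τ ρ : ℝ, 0 < ρ → (∀ r, R < r → τ < ballVol * r ^ 4 → ρ < r) →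
      ∫⁻ r in Set.Ioi R, {r : ℝ | τ < ballVol * r ^ 4}.indicator
        (fun r => ENNReal.ofReal (r ^ (-3 : ℝ))) r ≤ ENNReal.ofReal (ρ ^ (-2 : ℝ) / 2) := by
    intro τ ρ hρ h
    have hms : MeasurableSet {r : ℝ | τ < ballVol * r ^ 4} :=
      measurableSet_lt (by fun_prop) (by fun_prop)
    rw [← lintegral_Ioi_rpow_neg_three hρ, lintegral_indicator hms, Measure.restrict_restrict hms]
    exact lintegral_mono_set fun r hr => h r hr.2 hr.1
  have hm : AEMeasurable (rearr Ω g) (volume.restrict (Set.Ioi 0)) := aemeasurable_rearr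
  set G := hm.mk (rearr Ω g) with hG
  have hGm : Measurable G := hm.measurable_mk
  have hGae : ∀ᵐ τ ∂(volume.restrict (Set.Ioi (0 : ℝ))), rearr Ω g τ = G τ := hm.ae_eq_mk
  obtain ⟨K, hK⟩ : ∃ K : ℝ → ℝ → ℝ≥0∞, ∀ r τ, K r τ =
      {z : ℝ × ℝ | z.2 < ballVol * z.1 ^ 4}.indicator
        (fun z => ENNReal.ofReal (z.1 ^ (-3 : ℝ)) * G z.2) (r, τ) := ⟨_, fun _ _ => rfl⟩
  have hKm : Measurable (Function.uncurry K) := by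
    have h1 : MeasurableSet {z : ℝ × ℝ | z.2 < ballVol * z.1 ^ 4} :=
      measurableSet_lt (by fun_prop) (by fun_prop)
    have h2 : Measurable fun z : ℝ × ℝ => ENNReal.ofReal (z.1 ^ (-3 : ℝ)) * G z.2 :=
      Measurable.mul (by fun_prop) (hGm.comp measurable_snd)
    have h3 : Function.uncurry K = {z : ℝ × ℝ | z.2 < ballVol * z.1 ^ 4}.indicator
        (fun z => ENNReal.ofReal (z.1 ^ (-3 : ℝ)) * G z.2) := by
      ext z
      exact hK z.1 z.2
    rw [h3]
    exact h2.indicator h1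
  calc ∫⁻ r in Set.Ioi R, ENNReal.ofReal (r ^ (-3 : ℝ)) * ∫⁻ y in Metric.ball x r, ‖g y‖ₑ
      ≤ ∫⁻ r in Set.Ioi R, ∫⁻ τ in Set.Ioi 0,
          K r τ := by
        refine setLIntegral_mono' measurableSet_Ioi fun r hr => ?_
        have hr0 : 0 < r := hRpos.trans hr
        calc _ ≤ ENNReal.ofReal (r ^ (-3 : ℝ)) *
              ∫⁻ τ in Set.Ioo 0 (ballVol * r ^ 4), rearr Ω g τ := by
              gcongr
              exact lintegral_ball_le_rearr hg hg0 x hr0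
          _ = ∫⁻ τ in Set.Iio (ballVol * r ^ 4) ∩ Set.Ioi 0,
                ENNReal.ofReal (r ^ (-3 : ℝ)) * G τ := by
              rw [Set.inter_comm, Set.Ioi_inter_Iio,
                ← lintegral_const_mul' _ _ ENNReal.ofReal_ne_top]
              refine lintegral_congr_ae ?_
              have hGae' : ∀ᵐ τ ∂(volume.restrict (Set.Ioo 0 (ballVol * r ^ 4))),
                  rearr Ω g τ = G τ :=
                ae_restrict_of_ae_restrict_of_subset Set.Ioo_subset_Ioi_self hGae
              filter_upwards [hGae'] with τ hτ
              rw [hτ]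
          _ = _ := by
              rw [← Measure.restrict_restrict measurableSet_Iio,
                ← lintegral_indicator measurableSet_Iio]
              refine lintegral_congr fun τ => ?_
              rw [hK]
              rfl
    _ = ∫⁻ τ in Set.Ioi 0, ∫⁻ r in Set.Ioi R,
          K r τ :=
        lintegral_lintegral_swap hKm.aemeasurable
    _ = ∫⁻ τ in Set.Ioi 0, (∫⁻ r in Set.Ioi R, {r : ℝ | τ < ballVol * r ^ 4}.indicator
          (fun r => ENNReal.ofReal (r ^ (-3 : ℝ))) r) * rearr Ω g τ := by
        refine lintegral_congr_ae ?_
        filter_upwards [hGae] with τ hτ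
        rw [hτ, ← lintegral_mul_const]
        · refine lintegral_congr fun r => ?_
          rw [hK]
          by_cases h : τ < ballVol * r ^ 4 <;> simp [Set.indicator, h]
        · refine Measurable.indicator (by fun_prop) ?_
          exact measurableSet_lt (by fun_prop) (by fun_prop)
    -- For `τ ≤ t` every radius beyond `R` may contribute; for `τ > t` only radii whose ball has
    -- volume above `τ`.
    _ ≤ (∫⁻ τ in Set.Ioc 0 t, ENNReal.ofReal (ballVol ^ (1 / 2 : ℝ) / 2) *
            (ENNReal.ofReal (t ^ (-(1 / 2) : ℝ)) * rearr Ω g τ)) +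
        ∫⁻ τ in Set.Ioi t, ENNReal.ofReal (ballVol ^ (1 / 2 : ℝ) / 2) *
          (ENNReal.ofReal (τ ^ (-(1 / 2) : ℝ)) * rearr Ω g τ) := by
        rw [← Set.Ioc_union_Ioi_eq_Ioi ht.le,
          lintegral_union measurableSet_Ioi (Set.Ioc_disjoint_Ioi le_rfl)]
        refine add_le_add (setLIntegral_mono' measurableSet_Ioc fun τ hτ => ?_)
          (setLIntegral_mono' measurableSet_Ioi fun τ hτ => ?_)
        · rw [← mul_assoc, ← ENNReal.ofReal_mul (by positivity), ← hval t ht]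
          gcongr
          exact hinner τ R hRpos fun r hr _ => hr
        · have hτ0 : 0 < τ := ht.trans hτ
          rw [← mul_assoc, ← ENNReal.ofReal_mul (by positivity), ← hval τ hτ0]
          gcongr
          exact hinner τ _ (Real.rpow_pos_of_pos (div_pos hτ0 hω) _)
            fun r hr h => hlt τ r hτ0 (hRpos.trans hr) h
    _ = _ := by
        rw [lintegral_const_mul' _ _ ENNReal.ofReal_ne_top,
          lintegral_const_mul' _ _ ENNReal.ofReal_ne_top,
          lintegral_const_mul' _ _ ENNReal.ofReal_ne_top, ← mul_add,
          setLIntegral_congr (Ioo_ae_eq_Ioc (a := 0) (b := t))]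

theorem measurable_lintegral_ball {H : EuclideanSpace ℝ (Fin 4) → ℝ≥0∞} (hH : Measurable H) :
    Measurable fun z : EuclideanSpace ℝ (Fin 4) × ℝ => ∫⁻ y in Metric.ball z.1 z.2, H y := by
  have h1 : (fun z : EuclideanSpace ℝ (Fin 4) × ℝ => ∫⁻ y in Metric.ball z.1 z.2, H y) =
      fun z => ∫⁻ y, {w : (EuclideanSpace ℝ (Fin 4) × ℝ) × EuclideanSpace ℝ (Fin 4) |
        dist w.2 w.1.1 < w.1.2}.indicator (fun w => H w.2) (z, y) := by
    ext z
    rw [← lintegral_indicator measurableSet_ball]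
    rfl
  rw [h1]
  refine Measurable.lintegral_prod_right ?_
  refine Measurable.indicator (by fun_prop) ?_
  exact measurableSet_lt (by fun_prop) (by fun_prop)

theorem lintegral_lintegral_ball {H : EuclideanSpace ℝ (Fin 4) → ℝ≥0∞} (hH : Measurable H)
    {r : ℝ} (hr : 0 ≤ r) :
    ∫⁻ x, ∫⁻ y in Metric.ball x r, H y = ENNReal.ofReal (ballVol * r ^ 4) * ∫⁻ y, H y := by
  have hms : MeasurableSet {w : EuclideanSpace ℝ (Fin 4) × EuclideanSpace ℝ (Fin 4) |
      dist w.2 w.1 < r} := measurableSet_lt (by fun_prop) (by fun_prop)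
  calc ∫⁻ x, ∫⁻ y in Metric.ball x r, H y
      = ∫⁻ x, ∫⁻ y, {w : EuclideanSpace ℝ (Fin 4) × EuclideanSpace ℝ (Fin 4) |
          dist w.2 w.1 < r}.indicator (fun w => H w.2) (x, y) := by
        refine lintegral_congr fun x => ?_
        rw [← lintegral_indicator measurableSet_ball]
        rfl
    _ = ∫⁻ y, ∫⁻ x, {w : EuclideanSpace ℝ (Fin 4) × EuclideanSpace ℝ (Fin 4) |
          dist w.2 w.1 < r}.indicator (fun w => H w.2) (x, y) :=
        lintegral_lintegral_swap ((Measurable.indicator (by fun_prop) hms).aemeasurable)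
    _ = ∫⁻ y, ENNReal.ofReal (ballVol * r ^ 4) * H y := by
        refine lintegral_congr fun y => ?_
        rw [← volume_ball_eq y hr, mul_comm, ← setLIntegral_const,
          ← lintegral_indicator measurableSet_ball]
        refine lintegral_congr fun x => ?_
        simp [Set.indicator, dist_comm]
    _ = _ := lintegral_const_mul _ hH

/-- The near part is not bounded pointwise, but its integral over `D` is: by Fubini each radius
contributes `r⁻³ · ballVol · r⁴` times the truncated mass, and `r` integrates to `R² / 2`. -/
theorem lintegral_near_le (hg : Measurable g) {D : Set (EuclideanSpace ℝ (Fin 4))} {R : ℝ}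
    (l : ℝ≥0∞) :
    ∫⁻ x in D, ∫⁻ r in Set.Ioc 0 R,
        ENNReal.ofReal (r ^ (-3 : ℝ)) * ∫⁻ y in Metric.ball x r, ‖g y‖ₑ ≤
      ENNReal.ofReal (ballVol * R ^ 2 / 2) * ((∫⁻ y, (‖g y‖ₑ - l)) + l * volume D) := by
  have hω := ballVol_pos
  have hmH : Measurable fun y => ‖g y‖ₑ - l := hg.enorm.sub_const _
  have hball : ∀ r : ℝ, 0 < r → ∫⁻ x in D, ∫⁻ y in Metric.ball x r, ‖g y‖ₑ ≤
      ENNReal.ofReal (ballVol * r ^ 4) * ((∫⁻ y, (‖g y‖ₑ - l)) + l * volume D) := by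
    intro r hr
    calc ∫⁻ x in D, ∫⁻ y in Metric.ball x r, ‖g y‖ₑ
        ≤ ∫⁻ x in D, ((∫⁻ y in Metric.ball x r, (‖g y‖ₑ - l)) +
            l * ENNReal.ofReal (ballVol * r ^ 4)) :=
          lintegral_mono fun x => lintegral_ball_le hg l x hr.le
      _ = (∫⁻ x in D, ∫⁻ y in Metric.ball x r, (‖g y‖ₑ - l)) +
            l * ENNReal.ofReal (ballVol * r ^ 4) * volume D := by
          rw [lintegral_add_right _ measurable_const, setLIntegral_const]
      _ ≤ (∫⁻ x, ∫⁻ y in Metric.ball x r, (‖g y‖ₑ - l)) +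
            l * ENNReal.ofReal (ballVol * r ^ 4) * volume D := by
          gcongr
          exact Measure.restrict_le_self
      _ = _ := by rw [lintegral_lintegral_ball hmH hr.le]; ring
  have hmeas : Measurable fun z : EuclideanSpace ℝ (Fin 4) × ℝ =>
      ENNReal.ofReal (z.2 ^ (-3 : ℝ)) * ∫⁻ y in Metric.ball z.1 z.2, ‖g y‖ₑ :=
    Measurable.mul (by fun_prop) (measurable_lintegral_ball hg.enorm)
  rw [lintegral_lintegral_swap hmeas.aemeasurable]
  calc ∫⁻ r in Set.Ioc 0 R, ∫⁻ x in D,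
        ENNReal.ofReal (r ^ (-3 : ℝ)) * ∫⁻ y in Metric.ball x r, ‖g y‖ₑ
      ≤ ∫⁻ r in Set.Ioc 0 R, ENNReal.ofReal (ballVol * r ^ (1 : ℝ)) *
          ((∫⁻ y, (‖g y‖ₑ - l)) + l * volume D) := by
        refine setLIntegral_mono' measurableSet_Ioc fun r hr => ?_
        rw [lintegral_const_mul' _ _ ENNReal.ofReal_ne_top]
        calc _ ≤ ENNReal.ofReal (r ^ (-3 : ℝ)) * (ENNReal.ofReal (ballVol * r ^ 4) *
              ((∫⁻ y, (‖g y‖ₑ - l)) + l * volume D)) := by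
              gcongr
              exact hball r hr.1
          _ = _ := by
              rw [← mul_assoc, ← ENNReal.ofReal_mul (Real.rpow_nonneg hr.1.le _)]
              congr 2
              have : r ^ (-3 : ℝ) * r ^ 4 = r ^ (1 : ℝ) := by
                rw [← Real.rpow_natCast, ← Real.rpow_add hr.1]; norm_num
              rw [← this]
              ring
    _ ≤ _ := by
        rw [lintegral_mul_const _ (by fun_prop), ← setLIntegral_congr Ioo_ae_eq_Ioc]
        gcongr
        refine (lintegral_Ioo_rpow_le (by norm_num) hω.le).trans (le_of_eq ?_)
        norm_num
        congr 1
        ring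

/-- The rearrangement of a potential is controlled by the rearrangement of its density. -/
theorem rearr_half_le (hf : Measurable f) (hg : Measurable g) (hg0 : ∀ x ∉ Ω, g x = 0)
    (hΩ : volume (Ω : Set (EuclideanSpace ℝ (Fin 4))) ≠ ∞)
    (hfg : ∀ x, ENNReal.ofReal ballVol * ‖f x‖ₑ ≤ ∫⁻ r in Set.Ioi (0 : ℝ),
      ENNReal.ofReal (r ^ (-3 : ℝ)) * ∫⁻ y in Metric.ball x r, ‖g y‖ₑ)
    {t : ℝ} (ht : 0 < t) :
    rearr Ω f (t / 2) ≤ ENNReal.ofReal (2 * ballVol ^ (-(1 / 2) : ℝ)) *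
      (ENNReal.ofReal (t ^ (-(1 / 2) : ℝ)) * (∫⁻ τ in Set.Ioo 0 t, rearr Ω g τ) +
        ∫⁻ τ in Set.Ioi t, ENNReal.ofReal (τ ^ (-(1 / 2) : ℝ)) * rearr Ω g τ) := by
  have hω := ballVol_pos
  set G := ∫⁻ τ in Set.Ioo 0 t, rearr Ω g τ with hG
  set J := ∫⁻ τ in Set.Ioi t, ENNReal.ofReal (τ ^ (-(1 / 2) : ℝ)) * rearr Ω g τ with hJ
  set Ψ := ENNReal.ofReal (t ^ (-(1 / 2) : ℝ)) * G + J with hΨ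
  have ht2 : 0 < t / 2 := by linarith
  by_contra! hlt
  -- If the bound fails, some level `s` above it has a superlevel set `D` of measure at least `t /
  -- 2`. Integrating the potential estimate over `D` and dividing by its measure contradicts this.
  obtain ⟨s, hs, hs'⟩ := exists_between hlt
  refine hs.not_ge ?_
  have hte := ofReal_le_distribFun_of_lt_rearr ht2 hs'
  set D := {x | x ∈ Ω ∧ s < ‖f x‖ₑ} with hD
  have hDm : MeasurableSet D :=
    Ω.isOpen.measurableSet.inter (measurableSet_lt measurable_const hf.enorm)
  set e := volume D with he
  change ENNReal.ofReal (t / 2) ≤ e at hte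
  have he_top : e ≠ ∞ := ((measure_mono fun x hx => hx.1).trans_lt hΩ.lt_top).ne
  have he0 : e ≠ 0 := fun h => by
    rw [h, nonpos_iff_eq_zero, ENNReal.ofReal_eq_zero] at hte
    linarith
  set R := (t / ballVol) ^ (1 / 4 : ℝ) with hR
  have hRpos : 0 < R := Real.rpow_pos_of_pos (div_pos ht hω) _
  set l := rearr Ω g t with hl
  set A := ∫⁻ y, (‖g y‖ₑ - l) with hA
  have hAG : A + l * ENNReal.ofReal t ≤ G := by
    rw [hA, lintegral_sub_eq_setLIntegral hg0]
    exact lintegral_sub_rearr_add_le hg.aemeasurable ht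
  -- The measure `e` of `D` may be far from `t`; `2 e / t ≥ 1` lets the truncation at `g*(t)` be
  -- compared with `∫₀ᵗ g*` at a cost proportional to `e`, which cancels later.
  have hAe : A + l * e ≤ e * ENNReal.ofReal (2 / t) * G := by
    have h2 : ENNReal.ofReal t * ENNReal.ofReal (2 / t) = 2 := by
      rw [← ENNReal.ofReal_mul ht.le, mul_div_cancel₀ _ ht.ne']; simp
    have h1 : 1 ≤ e * ENNReal.ofReal (2 / t) := by
      calc (1 : ℝ≥0∞) = ENNReal.ofReal (t / 2) * ENNReal.ofReal (2 / t) := by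
            rw [← ENNReal.ofReal_mul ht2.le]
            have : t / 2 * (2 / t) = 1 := by field_simp
            simp [this]
        _ ≤ _ := by gcongr
    calc A + l * e = 1 * A + 1 * (l * e) := by ring
      _ ≤ e * ENNReal.ofReal (2 / t) * A + 2 * (l * e) := by
          gcongr
          exact one_le_two
      _ = e * ENNReal.ofReal (2 / t) * (A + l * ENNReal.ofReal t) := by rw [← h2]; ring
      _ ≤ _ := by gcongr
  have hmain : ENNReal.ofReal ballVol * s * e ≤
      ENNReal.ofReal (ballVol * R ^ 2 / 2) * (e * ENNReal.ofReal (2 / t) * G) +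
        ENNReal.ofReal (ballVol ^ (1 / 2 : ℝ) / 2) * Ψ * e := by
    calc ENNReal.ofReal ballVol * s * e = ∫⁻ x in D, ENNReal.ofReal ballVol * s := by
          rw [setLIntegral_const]
      _ ≤ ∫⁻ x in D, ((∫⁻ r in Set.Ioc 0 R, ENNReal.ofReal (r ^ (-3 : ℝ)) *
            ∫⁻ y in Metric.ball x r, ‖g y‖ₑ) + ENNReal.ofReal (ballVol ^ (1 / 2 : ℝ) / 2) * Ψ) := by
          refine setLIntegral_mono' hDm fun x hx => ?_
          calc ENNReal.ofReal ballVol * s ≤ ENNReal.ofReal ballVol * ‖f x‖ₑ := by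
                gcongr
                exact hx.2.le
            _ ≤ _ := hfg x
            _ = _ := by
                rw [← Set.Ioc_union_Ioi_eq_Ioi hRpos.le,
                  lintegral_union measurableSet_Ioi (Set.Ioc_disjoint_Ioi le_rfl)]
            _ ≤ _ := add_le_add le_rfl (lintegral_tail_le hg hg0 x ht)
      _ = (∫⁻ x in D, ∫⁻ r in Set.Ioc 0 R, ENNReal.ofReal (r ^ (-3 : ℝ)) *
            ∫⁻ y in Metric.ball x r, ‖g y‖ₑ) +
            ENNReal.ofReal (ballVol ^ (1 / 2 : ℝ) / 2) * Ψ * e := by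
          rw [lintegral_add_right _ measurable_const, setLIntegral_const]
      _ ≤ _ := by
          gcongr
          exact (lintegral_near_le hg l).trans (by gcongr)
  have hmain' : ENNReal.ofReal ballVol * s ≤
      ENNReal.ofReal (ballVol * R ^ 2 / 2) * (ENNReal.ofReal (2 / t) * G) +
        ENNReal.ofReal (ballVol ^ (1 / 2 : ℝ) / 2) * Ψ := by
    rw [← ENNReal.mul_le_mul_iff_left he0 he_top]
    refine hmain.trans (le_of_eq ?_)
    ring
  have hRt : ballVol * R ^ 2 / 2 * (2 / t) = ballVol ^ (1 / 2 : ℝ) * t ^ (-(1 / 2) : ℝ) := by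
    have h1 : R ^ 2 = t ^ (1 / 2 : ℝ) * ballVol ^ (-(1 / 2) : ℝ) := by
      rw [hR, ← Real.rpow_natCast, ← Real.rpow_mul (div_pos ht hω).le, Real.div_rpow ht.le hω.le,
        div_eq_mul_inv, ← Real.rpow_neg hω.le]
      norm_num
    have h2 : ballVol * ballVol ^ (-(1 / 2) : ℝ) = ballVol ^ (1 / 2 : ℝ) := by
      nth_rw 1 [← Real.rpow_one ballVol]
      rw [← Real.rpow_add hω]; norm_num
    have h3 : t ^ (1 / 2 : ℝ) * t⁻¹ = t ^ (-(1 / 2) : ℝ) := by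
      rw [← Real.rpow_neg_one, ← Real.rpow_add ht]; norm_num
    rw [h1, ← h2, ← h3]
    ring
  -- The near part contributes at most `ballVol^(1/2) Ψ` and the far part half of that; the total
  -- `3/2` is rounded up to `2`.
  have hfin : ENNReal.ofReal ballVol * s ≤
      ENNReal.ofReal ballVol * (ENNReal.ofReal (2 * ballVol ^ (-(1 / 2) : ℝ)) * Ψ) := by
    have h2 : ballVol * (2 * ballVol ^ (-(1 / 2) : ℝ)) =
        ballVol ^ (1 / 2 : ℝ) + ballVol ^ (1 / 2 : ℝ) := by
      have : ballVol * ballVol ^ (-(1 / 2) : ℝ) = ballVol ^ (1 / 2 : ℝ) := by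
        nth_rw 1 [← Real.rpow_one ballVol]
        rw [← Real.rpow_add hω]; norm_num
      rw [← this]; ring
    have hp := Real.rpow_pos_of_pos hω (1 / 2 : ℝ)
    refine hmain'.trans ?_
    rw [← mul_assoc, ← ENNReal.ofReal_mul (by positivity), hRt, ← mul_assoc,
      ← ENNReal.ofReal_mul hω.le, h2, ENNReal.ofReal_add hp.le hp.le, add_mul,
      ENNReal.ofReal_mul hp.le, mul_assoc]
    gcongr
    · exact le_self_add
    · linarith
  exact (ENNReal.mul_le_mul_iff_right (by simpa using hω) ENNReal.ofReal_ne_top).1 hfin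

end Potential

/-! ### Test functions and the `L²` identity between Hessian and Laplacian -/

section PartialDerivatives

variable {N : ℕ}

/-- The classical partial derivative `∂ᵢ φ`. -/
noncomputable def pd (i : Fin N) (φ : EuclideanSpace ℝ (Fin N) → ℝ) :
    EuclideanSpace ℝ (Fin N) → ℝ :=
  fun x => fderiv ℝ φ x (EuclideanSpace.single i 1)

/-- Smooth functions with compact support. -/
structure IsTest (φ : EuclideanSpace ℝ (Fin N) → ℝ) : Prop where
  contDiff : ContDiff ℝ (⊤ : ℕ∞) φ
  hasCompactSupport : HasCompactSupport φ

variable {φ ψ : EuclideanSpace ℝ (Fin N) → ℝ}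

theorem IsTest.continuous (hφ : IsTest φ) : Continuous φ := hφ.contDiff.continuous

theorem IsTest.differentiable (hφ : IsTest φ) : Differentiable ℝ φ :=
  hφ.contDiff.differentiable (by simp)

theorem IsTest.fderiv_apply (hφ : IsTest φ) (v : EuclideanSpace ℝ (Fin N)) :
    IsTest fun x => fderiv ℝ φ x v :=
  ⟨(hφ.contDiff.fderiv_right (m := (⊤ : ℕ∞)) (by simp)).clm_apply contDiff_const,
    hφ.hasCompactSupport.fderiv_apply (𝕜 := ℝ) v⟩

theorem IsTest.pd (hφ : IsTest φ) (i : Fin N) : IsTest (pd i φ) := hφ.fderiv_apply _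

theorem tsupport_pd_subset (i : Fin N) (φ : EuclideanSpace ℝ (Fin N) → ℝ) :
    tsupport (pd i φ) ⊆ tsupport φ := tsupport_fderiv_apply_subset ℝ _

theorem IsTest.mul_integrable (hφ : IsTest φ) (hψ : IsTest ψ) :
    Integrable fun x => φ x * ψ x :=
  (hφ.continuous.mul hψ.continuous).integrable_of_hasCompactSupport
    hφ.hasCompactSupport.mul_right

theorem IsTest.integral_mul_pd (hφ : IsTest φ) (hψ : IsTest ψ) (i : Fin N) :
    ∫ x, φ x * LorentzZygmund.pd i ψ x = -∫ x, LorentzZygmund.pd i φ x * ψ x :=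
  integral_mul_fderiv_eq_neg_fderiv_mul_of_integrable ((hφ.pd i).mul_integrable hψ)
    (hφ.mul_integrable (hψ.pd i)) (hφ.mul_integrable hψ) (fun x _ => hφ.differentiable x)
    (fun x _ => hψ.differentiable x)

theorem IsTest.fderiv_fderiv_apply (hφ : IsTest φ) (x v w : EuclideanSpace ℝ (Fin N)) :
    fderiv ℝ (fun y => fderiv ℝ φ y v) x w = fderiv ℝ (fderiv ℝ φ) x w v := by
  have h : DifferentiableAt ℝ (fderiv ℝ φ) x :=
    ((hφ.contDiff.fderiv_right (m := (⊤ : ℕ∞)) (by simp)).differentiable (by simp)) x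
  have h2 := (h.hasFDerivAt.clm_apply (hasFDerivAt_const v x)).fderiv
  rw [h2]
  simp

theorem IsTest.pd_comm (hφ : IsTest φ) (i j : Fin N) :
    LorentzZygmund.pd i (LorentzZygmund.pd j φ) = LorentzZygmund.pd j (LorentzZygmund.pd i φ) := by
  ext x
  unfold LorentzZygmund.pd
  rw [hφ.fderiv_fderiv_apply, hφ.fderiv_fderiv_apply]
  exact (hφ.contDiff.contDiffAt.isSymmSndFDerivAt 
    (by simpa using WithTop.coe_le_coe.2 (le_top (a := (2 : ℕ∞))))) _ _

/-- Both sides equal `-∫ ∂ⱼ∂ⱼ∂ᵢφ · ∂ᵢφ`, by one integration by parts each and commuting derivatives.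
Summed over `i, j` this is why the Laplacian alone controls all second derivatives. -/
theorem IsTest.integral_pd_pd_sq (hφ : IsTest φ) (i j : Fin N) :
    ∫ x, LorentzZygmund.pd j (LorentzZygmund.pd i φ) x ^ 2 =
      ∫ x, LorentzZygmund.pd i (LorentzZygmund.pd i φ) x *
        LorentzZygmund.pd j (LorentzZygmund.pd j φ) x := by
  have h1 := ((hφ.pd i).pd j).integral_mul_pd (hφ.pd i) j
  have h2 := ((hφ.pd j).pd j).integral_mul_pd (hφ.pd i) i
  have h3 : LorentzZygmund.pd i (LorentzZygmund.pd j (LorentzZygmund.pd j φ)) =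
      LorentzZygmund.pd j (LorentzZygmund.pd j (LorentzZygmund.pd i φ)) := by
    rw [(hφ.pd j).pd_comm i j, hφ.pd_comm i j]
  rw [h3] at h2
  simp only [sq]
  rw [h1, ← h2]
  simp only [mul_comm]

/-- The Laplacian of a smooth function. -/
noncomputable def lap (φ : EuclideanSpace ℝ (Fin N) → ℝ) : EuclideanSpace ℝ (Fin N) → ℝ :=
  fun x => ∑ i, pd i (pd i φ) x

/-- The sum of the absolute values of the second partial derivatives. -/
noncomputable def hessSum (φ : EuclideanSpace ℝ (Fin N) → ℝ) : EuclideanSpace ℝ (Fin N) → ℝ :=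
  fun x => ∑ i, ∑ j, |pd j (pd i φ) x|

theorem IsTest.continuous_hessSum (hφ : IsTest φ) : Continuous (hessSum φ) :=
  continuous_finsetSum _ fun i _ => continuous_finsetSum _ fun j _ =>
    ((hφ.pd i).pd j).continuous.abs

theorem hessSum_nonneg (φ : EuclideanSpace ℝ (Fin N) → ℝ) (x : EuclideanSpace ℝ (Fin N)) :
    0 ≤ hessSum φ x := Finset.sum_nonneg fun _ _ => Finset.sum_nonneg fun _ _ => abs_nonneg _

theorem hessSum_eq_zero {x : EuclideanSpace ℝ (Fin N)} (hx : x ∉ tsupport φ) :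
    hessSum φ x = 0 := by
  refine Finset.sum_eq_zero fun i _ => Finset.sum_eq_zero fun j _ => ?_
  rw [abs_eq_zero]
  exact image_eq_zero_of_notMem_tsupport fun h =>
    hx (tsupport_pd_subset i _ (tsupport_pd_subset j _ h))

theorem IsTest.integral_lap_sq (hφ : IsTest φ) :
    ∫ x, lap φ x ^ 2 = ∑ i, ∑ j, ∫ x, LorentzZygmund.pd j (LorentzZygmund.pd i φ) x ^ 2 := by
  simp only [hφ.integral_pd_pd_sq]
  have h : ∀ x, lap φ x ^ 2 = ∑ i, ∑ j, LorentzZygmund.pd i (LorentzZygmund.pd i φ) x *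
        LorentzZygmund.pd j (LorentzZygmund.pd j φ) x := fun x => by
    rw [lap, sq, Finset.sum_mul_sum]
  simp only [h]
  rw [integral_finsetSum _ fun i _ => integrable_finsetSum _ fun j _ =>
    ((hφ.pd i).pd i).mul_integrable ((hφ.pd j).pd j)]
  refine Finset.sum_congr rfl fun i _ => ?_
  rw [integral_finsetSum _ fun j _ => ((hφ.pd i).pd i).mul_integrable ((hφ.pd j).pd j)]

/-- Cauchy–Schwarz in each of the two finite sums costs a factor `N`; the sum of squares that
remains integrates to `∫ (Δφ)²`. -/
theorem IsTest.lintegral_hessSum_sq_le (hφ : IsTest φ) :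
    ∫⁻ x, ‖hessSum φ x‖ₑ ^ 2 ≤ (N : ℝ≥0∞) ^ 2 * ∫⁻ x, ‖lap φ x‖ₑ ^ 2 := by
  have hsq : ∀ F : EuclideanSpace ℝ (Fin N) → ℝ, ∀ x, ‖F x‖ₑ ^ 2 = ENNReal.ofReal (F x ^ 2) := by
    intro F x
    rw [← sq_abs, ENNReal.ofReal_pow (abs_nonneg _), Real.enorm_eq_ofReal_abs]
  simp only [hsq]
  have hint : ∀ i j, Integrable fun x =>
      LorentzZygmund.pd j (LorentzZygmund.pd i φ) x ^ 2 := fun i j => by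
    simpa only [sq] using ((hφ.pd i).pd j).mul_integrable ((hφ.pd i).pd j)
  have hle : ∀ x, hessSum φ x ^ 2 ≤
      (N : ℝ) ^ 2 * ∑ i, ∑ j, LorentzZygmund.pd j (LorentzZygmund.pd i φ) x ^ 2 := by
    intro x
    have h1 : hessSum φ x ^ 2 ≤ (N : ℝ) *
        ∑ i, (∑ j, |LorentzZygmund.pd j (LorentzZygmund.pd i φ) x|) ^ 2 := by
      simpa [hessSum] using sq_sum_le_card_mul_sum_sq (s := Finset.univ)
        (f := fun i => ∑ j, |LorentzZygmund.pd j (LorentzZygmund.pd i φ) x|)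
    have h2 : ∀ i, (∑ j, |LorentzZygmund.pd j (LorentzZygmund.pd i φ) x|) ^ 2 ≤
        (N : ℝ) * ∑ j, LorentzZygmund.pd j (LorentzZygmund.pd i φ) x ^ 2 := fun i => by
      simpa using sq_sum_le_card_mul_sum_sq (s := Finset.univ)
        (f := fun j => |LorentzZygmund.pd j (LorentzZygmund.pd i φ) x|)
    calc hessSum φ x ^ 2 ≤ _ := h1
      _ ≤ (N : ℝ) * ∑ i, ((N : ℝ) * ∑ j, LorentzZygmund.pd j (LorentzZygmund.pd i φ) x ^ 2) := by
        gcongr with i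
        exact h2 i
      _ = _ := by rw [← Finset.mul_sum]; ring
  have hlap : Integrable fun x => lap φ x ^ 2 := by
    have h : (fun x => lap φ x ^ 2) = fun x => ∑ i, ∑ j,
        LorentzZygmund.pd i (LorentzZygmund.pd i φ) x *
          LorentzZygmund.pd j (LorentzZygmund.pd j φ) x := by
      ext x
      rw [lap, sq, Finset.sum_mul_sum]
    rw [h]
    exact integrable_finsetSum _ fun i _ => integrable_finsetSum _ fun j _ =>
      ((hφ.pd i).pd i).mul_integrable ((hφ.pd j).pd j)
  have hsum : Integrable fun x =>
      (N : ℝ) ^ 2 * ∑ i, ∑ j, LorentzZygmund.pd j (LorentzZygmund.pd i φ) x ^ 2 :=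
    (integrable_finsetSum _ fun i _ => integrable_finsetSum _ fun j _ => hint i j).const_mul _
  calc ∫⁻ x, ENNReal.ofReal (hessSum φ x ^ 2)
      ≤ ∫⁻ x, ENNReal.ofReal ((N : ℝ) ^ 2 *
          ∑ i, ∑ j, LorentzZygmund.pd j (LorentzZygmund.pd i φ) x ^ 2) :=
        lintegral_mono fun x => ENNReal.ofReal_le_ofReal (hle x)
    _ = ENNReal.ofReal ((N : ℝ) ^ 2 * ∫ x, lap φ x ^ 2) := by
        rw [← ofReal_integral_eq_lintegral_ofReal hsum (Filter.Eventually.of_forall fun x => by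
          positivity), integral_const_mul, hφ.integral_lap_sq,
          integral_finsetSum _ fun i _ => integrable_finsetSum _ fun j _ => hint i j]
        congr 2
        refine Finset.sum_congr rfl fun i _ => ?_
        rw [integral_finsetSum _ fun j _ => hint i j]
    _ = _ := by
        rw [ENNReal.ofReal_mul (by positivity),
          ofReal_integral_eq_lintegral_ofReal hlap (Filter.Eventually.of_forall fun x => by
          positivity)]
        congr 1
        rw [ENNReal.ofReal_pow (by positivity), ENNReal.ofReal_natCast]

theorem eq_sum_smul_single (v : EuclideanSpace ℝ (Fin N)) :
    v = ∑ i, v i • EuclideanSpace.single i (1 : ℝ) := by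
  ext j
  simp [Finset.sum_apply, Pi.single_apply]

theorem IsTest.abs_fderiv_fderiv_le (hφ : IsTest φ) (x v : EuclideanSpace ℝ (Fin N))
    (hv : ‖v‖ ≤ 1) : |fderiv ℝ (fun y => fderiv ℝ φ y v) x v| ≤ hessSum φ x := by
  have hvi : ∀ i, |v i| ≤ 1 := fun i => (PiLp.norm_apply_le v i).trans hv
  have hexp : fderiv ℝ (fun y => fderiv ℝ φ y v) x v =
      ∑ i, ∑ j, v i * (v j * LorentzZygmund.pd i (LorentzZygmund.pd j φ) x) := by
    have hpd : ∀ i j, LorentzZygmund.pd i (LorentzZygmund.pd j φ) x = fderiv ℝ (fderiv ℝ φ) x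
        (EuclideanSpace.single i 1) (EuclideanSpace.single j 1) := fun i j =>
      hφ.fderiv_fderiv_apply x _ _
    simp only [hpd, hφ.fderiv_fderiv_apply]
    generalize fderiv ℝ (fderiv ℝ φ) x = B
    conv_lhs => rw [eq_sum_smul_single v]
    simp only [map_sum, map_smul, sum_apply, smul_apply,
      smul_eq_mul, Finset.mul_sum]
    rw [Finset.sum_comm]
    exact Finset.sum_congr rfl fun i _ => Finset.sum_congr rfl fun j _ => by ring
  rw [hexp, hessSum, Finset.sum_comm]
  refine (Finset.abs_sum_le_sum_abs _ _).trans (Finset.sum_le_sum fun j _ =>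
    (Finset.abs_sum_le_sum_abs _ _).trans (Finset.sum_le_sum fun i _ => ?_))
  rw [abs_mul, abs_mul]
  calc |v i| * (|v j| * |LorentzZygmund.pd i (LorentzZygmund.pd j φ) x|)
      ≤ 1 * (1 * |LorentzZygmund.pd i (LorentzZygmund.pd j φ) x|) := by
        gcongr
        · exact hvi i
        · exact hvi j
    _ = _ := by ring

end PartialDerivatives

/-! ### Representation of a test function along rays -/

section Ray

variable {N : ℕ} {φ : EuclideanSpace ℝ (Fin N) → ℝ}

/-- Taylor's formula with integral remainder from beyond the support, `φ(x) = ∫₀^R r ∂ᵥ²φ(x + r v)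
dr`, combined with the bound of `∂ᵥ²φ` by `hessSum φ` for `‖v‖ ≤ 1`. -/
theorem IsTest.enorm_le_lintegral_ray (hφ : IsTest φ) (x : EuclideanSpace ℝ (Fin N))
    {v : EuclideanSpace ℝ (Fin N)} (hv0 : v ≠ 0) (hv : ‖v‖ ≤ 1) :
    ‖φ x‖ₑ ≤ ∫⁻ r in Set.Ioi (0 : ℝ), ENNReal.ofReal r * ‖hessSum φ (x + r • v)‖ₑ := by
  set ψ : EuclideanSpace ℝ (Fin N) → ℝ := fun y => fderiv ℝ φ y v with hψ
  have hψt : IsTest ψ := hφ.fderiv_apply v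
  obtain ⟨M, hM⟩ := hφ.hasCompactSupport.isBounded.subset_closedBall 0
  have hvpos : 0 < ‖v‖ := norm_pos_iff.2 hv0
  -- Far enough that `x + R v` leaves the ball containing the support.
  set R := (|M| + ‖x‖ + 1) / ‖v‖ with hR
  have hRpos : 0 < R := by positivity
  have hout : x + R • v ∉ tsupport φ := by
    intro h
    have h1 := hM h
    rw [mem_closedBall_zero_iff] at h1
    have h2 : ‖R • v‖ = |M| + ‖x‖ + 1 := by
      rw [norm_smul, Real.norm_of_nonneg hRpos.le, hR, div_mul_cancel₀ _ hvpos.ne']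
    have h3 : ‖R • v‖ ≤ ‖x + R • v‖ + ‖x‖ := by
      calc ‖R • v‖ = ‖(x + R • v) - x‖ := by congr 1; abel
        _ ≤ _ := norm_sub_le _ _
    linarith [le_abs_self M]
  have hφR : φ (x + R • v) = 0 := image_eq_zero_of_notMem_tsupport hout
  have hψR : ψ (x + R • v) = 0 := image_eq_zero_of_notMem_tsupport fun h =>
    hout (tsupport_fderiv_apply_subset ℝ v h)
  have hline : ∀ r : ℝ, HasDerivAt (fun r : ℝ => x + r • v) v r := fun r => by
    simpa using ((hasDerivAt_id r).smul_const v).const_add x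
  have hd1 : ∀ r : ℝ, HasDerivAt (fun r : ℝ => φ (x + r • v)) (ψ (x + r • v)) r := fun r =>
    (hφ.differentiable _).hasFDerivAt.comp_hasDerivAt r (hline r)
  have hd2 : ∀ r : ℝ, HasDerivAt (fun r : ℝ => ψ (x + r • v)) (fderiv ℝ ψ (x + r • v) v) r :=
    fun r => (hψt.differentiable _).hasFDerivAt.comp_hasDerivAt r (hline r)
  -- This primitive of the remainder vanishes at `R` and equals `-φ x` at `0`.
  have hd3 : ∀ r : ℝ, HasDerivAt (fun r : ℝ => r * ψ (x + r • v) - φ (x + r • v))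
      (r * fderiv ℝ ψ (x + r • v) v) r := fun r => by
    refine (((hasDerivAt_id r).mul (hd2 r)).sub (hd1 r)).congr_deriv ?_
    simp
  have hcont : Continuous fun r : ℝ => r * fderiv ℝ ψ (x + r • v) v :=
    continuous_id.mul ((hψt.fderiv_apply v).continuous.comp (by fun_prop))
  have hFTC := intervalIntegral.integral_eq_sub_of_hasDerivAt (a := 0) (b := R)
    (fun r _ => hd3 r) (hcont.intervalIntegrable _ _)
  rw [hφR, hψR, intervalIntegral.integral_of_le hRpos.le] at hFTC
  simp only [mul_zero, zero_mul, zero_smul, add_zero, sub_zero, zero_sub, sub_neg_eq_add,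
    zero_add] at hFTC
  rw [← hFTC]
  refine (enorm_integral_le_lintegral_enorm _).trans ?_
  refine le_trans (setLIntegral_mono' measurableSet_Ioc fun r hr => ?_)
    (lintegral_mono_set Set.Ioc_subset_Ioi_self)
  rw [enorm_mul, Real.enorm_of_nonneg hr.1.le]
  gcongr
  rw [Real.enorm_of_nonneg (hessSum_nonneg φ _), Real.enorm_eq_ofReal_abs]
  exact ENNReal.ofReal_le_ofReal (hφ.abs_fderiv_fderiv_le _ v hv)

end Ray

/-! ### Averaging over directions -/

section Averaging

variable {φ : EuclideanSpace ℝ (Fin 4) → ℝ}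

theorem lintegral_unitBall_comp {H : EuclideanSpace ℝ (Fin 4) → ℝ≥0∞} (hH : Measurable H)
    (x : EuclideanSpace ℝ (Fin 4)) {r : ℝ} (hr : 0 < r) :
    ∫⁻ v in Metric.ball 0 1, H (x + r • v) =
      ENNReal.ofReal (r ^ (-4 : ℝ)) * ∫⁻ y in Metric.ball x r, H y := by
  have hF : Measurable ((Metric.ball x r).indicator H) := hH.indicator measurableSet_ball
  calc ∫⁻ v in Metric.ball 0 1, H (x + r • v)
      = ∫⁻ v, (fun w => (Metric.ball x r).indicator H (x + w)) (r • v) := by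
        rw [← lintegral_indicator measurableSet_ball]
        refine lintegral_congr fun v => ?_
        simp [Set.indicator, norm_smul, abs_of_pos hr, mul_lt_iff_lt_one_right hr]
    _ = ∫⁻ w, (Metric.ball x r).indicator H (x + w)
          ∂(Measure.map (r • · : EuclideanSpace ℝ (Fin 4) → _) volume) := by
        rw [lintegral_map (by fun_prop) (by fun_prop)]
    _ = _ := by
        rw [Measure.map_addHaar_smul volume hr.ne', lintegral_smul_measure,
          lintegral_add_left_eq_self ((Metric.ball x r).indicator H),
          lintegral_indicator measurableSet_ball]
        congr 2
        rw [Real.rpow_neg hr.le, abs_of_pos (by positivity)]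
        simp

/-- A compactly supported function is controlled by averages of its second derivatives. -/
theorem IsTest.enorm_le_lintegral_ball (hφ : IsTest φ) (x : EuclideanSpace ℝ (Fin 4)) :
    ENNReal.ofReal ballVol * ‖φ x‖ₑ ≤ ∫⁻ r in Set.Ioi (0 : ℝ),
      ENNReal.ofReal (r ^ (-3 : ℝ)) * ∫⁻ y in Metric.ball x r, ‖hessSum φ y‖ₑ := by
  have hg := hφ.continuous_hessSum
  have hgm : Measurable (hessSum φ) := hg.measurable
  calc ENNReal.ofReal ballVol * ‖φ x‖ₑ
      = ∫⁻ v in Metric.ball (0 : EuclideanSpace ℝ (Fin 4)) 1, ‖φ x‖ₑ := by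
        rw [setLIntegral_const, ofReal_ballVol, mul_comm]
    _ ≤ ∫⁻ v in Metric.ball (0 : EuclideanSpace ℝ (Fin 4)) 1, ∫⁻ r in Set.Ioi (0 : ℝ),
          ENNReal.ofReal r * ‖hessSum φ (x + r • v)‖ₑ := by
        refine lintegral_mono_ae ?_
        -- The average is over the solid unit ball rather than the sphere, so scaling replaces polar
        -- coordinates. The direction `v = 0`, whose ray never leaves the support, is a null set.
        filter_upwards [ae_restrict_mem measurableSet_ball,
          ae_restrict_of_ae (Measure.ae_ne volume 0)] with v hv hv0
        exact hφ.enorm_le_lintegral_ray x hv0 (mem_ball_zero_iff.1 hv).le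
    _ = ∫⁻ r in Set.Ioi (0 : ℝ), ∫⁻ v in Metric.ball (0 : EuclideanSpace ℝ (Fin 4)) 1,
          ENNReal.ofReal r * ‖hessSum φ (x + r • v)‖ₑ := by
        refine lintegral_lintegral_swap (Measurable.aemeasurable ?_)
        simp only [Function.uncurry_def]
        fun_prop
    _ = _ := by
        refine setLIntegral_congr_fun measurableSet_Ioi fun r hr => ?_
        have hr0 : 0 < r := hr
        change ∫⁻ v in Metric.ball (0 : EuclideanSpace ℝ (Fin 4)) 1,
          ENNReal.ofReal r * ‖hessSum φ (x + r • v)‖ₑ = _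
        rw [lintegral_const_mul' _ _ ENNReal.ofReal_ne_top,
          lintegral_unitBall_comp hgm.enorm x hr0, ← mul_assoc, ← ENNReal.ofReal_mul hr0.le]
        congr 2
        nth_rw 1 [← Real.rpow_one r]
        rw [← Real.rpow_add hr0]
        norm_num

end Averaging

/-! ### Weak derivatives and approximation by test functions -/

section WeakDerivatives

variable {N : ℕ} {Ω : Opens (EuclideanSpace ℝ (Fin N))}
  {u u' v v' φ : EuclideanSpace ℝ (Fin N) → ℝ} {i : Fin N}

theorem isTest_testFunction (φ : 𝓓(Ω, ℝ)) : IsTest φ := ⟨φ.contDiff, φ.hasCompactSupport⟩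

theorem integrableOn_mul_of_tsupport_subset
    (hu : LocallyIntegrableOn u (Ω : Set (EuclideanSpace ℝ (Fin N)))) (hφ : IsTest φ)
    (hs : tsupport φ ⊆ Ω) :
    IntegrableOn (fun x => u x * φ x) (Ω : Set (EuclideanSpace ℝ (Fin N))) := by
  have h1 : IntegrableOn u (tsupport φ) :=
    hu.integrableOn_compact_subset hs hφ.hasCompactSupport
  have h2 : IntegrableOn (fun x => u x * φ x) (tsupport φ) :=
    h1.mul_continuousOn hφ.continuous.continuousOn hφ.hasCompactSupport
  have h3 : Integrable fun x => u x * φ x := by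
    refine (integrableOn_iff_integrable_of_support_subset fun x hx => ?_).1 h2
    exact subset_tsupport φ (right_ne_zero_of_mul hx)
  exact h3.integrableOn

theorem lineDeriv_testFunction (φ : 𝓓(Ω, ℝ)) (x : EuclideanSpace ℝ (Fin N)) :
    lineDeriv ℝ φ x (EuclideanSpace.single i (1 : ℝ)) = pd i φ x :=
  ((isTest_testFunction φ).differentiable x).lineDeriv_eq_fderiv

theorem tsupport_pd_testFunction (φ : 𝓓(Ω, ℝ)) : tsupport (pd i φ) ⊆ Ω :=
  (tsupport_pd_subset i φ).trans φ.tsupport_subset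

/-- The fundamental lemma of the calculus of variations. Since `weakPartial` is an arbitrary choice
of representative, every computation with it goes through this uniqueness. -/
theorem IsWeakPartial.ae_unique (h : IsWeakPartial Ω i u v) (h' : IsWeakPartial Ω i u v') :
    v =ᵐ[volume.restrict (Ω : Set (EuclideanSpace ℝ (Fin N)))] v' := by
  have hae := Ω.isOpen.ae_eq_zero_of_integral_contDiff_smul_eq_zero (μ := volume)
    (h.2.1.sub h'.2.1) (by
      intro g hg hgc hgs
      set φ : 𝓓(Ω, ℝ) := ⟨g, hg, hgc, hgs⟩
      have hφ : IsTest g := ⟨hg, hgc⟩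
      have e : ∫ x in (Ω : Set (EuclideanSpace ℝ (Fin N))), v x * g x =
          ∫ x in (Ω : Set (EuclideanSpace ℝ (Fin N))), v' x * g x :=
        neg_injective ((h.2.2 φ).symm.trans (h'.2.2 φ))
      rw [← setIntegral_eq_integral_of_forall_compl_eq_zero
        (s := (Ω : Set (EuclideanSpace ℝ (Fin N))))]
      · have e2 : ∀ x, g x • (v - v') x = v x * g x - v' x * g x := fun x => by
          simp only [Pi.sub_apply, smul_eq_mul]; ring
        simp only [e2]
        rw [integral_sub (integrableOn_mul_of_tsupport_subset h.2.1 hφ hgs)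
          (integrableOn_mul_of_tsupport_subset h'.2.1 hφ hgs), e, sub_self]
      · intro x hx
        rw [image_eq_zero_of_notMem_tsupport fun hx' => hx (hgs hx'), zero_smul])
  rw [Filter.EventuallyEq, ae_restrict_iff' Ω.isOpen.measurableSet]
  filter_upwards [hae] with x hx hxΩ
  exact sub_eq_zero.1 (hx hxΩ)

theorem IsWeakPartial.congr_left (h : IsWeakPartial Ω i u v)
    (hu : u =ᵐ[volume.restrict (Ω : Set (EuclideanSpace ℝ (Fin N)))] u')
    (hu' : LocallyIntegrableOn u' (Ω : Set (EuclideanSpace ℝ (Fin N)))) :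
    IsWeakPartial Ω i u' v := by
  refine ⟨hu', h.2.1, fun φ => ?_⟩
  rw [← h.2.2 φ]
  refine integral_congr_ae ?_
  filter_upwards [hu] with x hx
  rw [hx]

theorem IsWeakPartial.sub (h : IsWeakPartial Ω i u v) (h' : IsWeakPartial Ω i u' v') :
    IsWeakPartial Ω i (fun x => u x - u' x) (fun x => v x - v' x) := by
  refine ⟨h.1.sub h'.1, h.2.1.sub h'.2.1, fun φ => ?_⟩
  have hφ := isTest_testFunction φ
  have h1 := h.2.2 φ
  have h2 := h'.2.2 φ
  simp only [lineDeriv_testFunction] at h1 h2 ⊢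
  simp only [sub_mul]
  rw [integral_sub (integrableOn_mul_of_tsupport_subset h.1 (hφ.pd i) (tsupport_pd_testFunction φ))
      (integrableOn_mul_of_tsupport_subset h'.1 (hφ.pd i) (tsupport_pd_testFunction φ)),
    integral_sub (integrableOn_mul_of_tsupport_subset h.2.1 hφ φ.tsupport_subset)
      (integrableOn_mul_of_tsupport_subset h'.2.1 hφ φ.tsupport_subset), h1, h2]
  ring

theorem IsTest.isWeakPartial (hφ : IsTest φ) (i : Fin N) : 
    IsWeakPartial Ω i φ (LorentzZygmund.pd i φ) := by
  refine ⟨hφ.continuous.locallyIntegrable.locallyIntegrableOn _,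
    (hφ.pd i).continuous.locallyIntegrable.locallyIntegrableOn _, fun ψ => ?_⟩
  simp only [lineDeriv_testFunction]
  rw [setIntegral_eq_integral_of_forall_compl_eq_zero,
    setIntegral_eq_integral_of_forall_compl_eq_zero]
  · exact hφ.integral_mul_pd (isTest_testFunction ψ) i
  · intro x hx
    rw [image_eq_zero_of_notMem_tsupport fun hx' => hx (ψ.tsupport_subset hx'), mul_zero]
  · intro x hx
    rw [image_eq_zero_of_notMem_tsupport fun hx' => hx (tsupport_pd_testFunction ψ hx'), mul_zero]

theorem isWeakPartial_weakPartial (h : ∃ v, IsWeakPartial Ω i u v) :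
    IsWeakPartial Ω i u (weakPartial Ω i u) := by
  unfold weakPartial
  rw [dif_pos h]
  exact h.choose_spec

theorem MemH2.weakPartial_sub (hu : MemH2 Ω u) (hφ : IsTest φ) (i : Fin N) :
    weakPartial Ω i (fun x => u x - φ x)
      =ᵐ[volume.restrict (Ω : Set (EuclideanSpace ℝ (Fin N)))]
        fun x => weakPartial Ω i u x - pd i φ x := by
  have h := (isWeakPartial_weakPartial (hu.exists_first i)).sub (hφ.isWeakPartial i)
  exact (isWeakPartial_weakPartial ⟨_, h⟩).ae_unique h

/-- The inner `weakPartial` of the difference agrees with the difference of first derivatives only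
almost everywhere, so the second derivative is transported by `IsWeakPartial.congr_left`. -/
theorem MemH2.isWeakPartial_weakPartial_sub (hu : MemH2 Ω u) (hφ : IsTest φ) (i j : Fin N) :
    IsWeakPartial Ω j (weakPartial Ω i fun x => u x - φ x)
      (fun x => weakPartial Ω j (weakPartial Ω i u) x - pd j (pd i φ) x) := by
  have h := (isWeakPartial_weakPartial (hu.exists_first i)).sub (hφ.isWeakPartial (Ω := Ω) i)
  exact ((isWeakPartial_weakPartial (hu.exists_second i j)).sub
    ((hφ.pd i).isWeakPartial j)).congr_left (hu.weakPartial_sub hφ i).symm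
      (isWeakPartial_weakPartial ⟨_, h⟩).2.1

theorem MemH2.weakLaplacian_sub (hu : MemH2 Ω u) (hφ : IsTest φ) :
    weakLaplacian Ω (fun x => u x - φ x)
      =ᵐ[volume.restrict (Ω : Set (EuclideanSpace ℝ (Fin N)))]
        fun x => weakLaplacian Ω u x - lap φ x := by
  have h : ∀ᵐ x ∂(volume.restrict (Ω : Set (EuclideanSpace ℝ (Fin N)))), ∀ i,
      weakPartial Ω i (weakPartial Ω i fun x => u x - φ x) x =
        weakPartial Ω i (weakPartial Ω i u) x - pd i (pd i φ) x := by
    rw [ae_all_iff]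
    intro i
    have h := hu.isWeakPartial_weakPartial_sub hφ i i
    exact (isWeakPartial_weakPartial ⟨_, h⟩).ae_unique h
  filter_upwards [h] with x hx
  simp only [weakLaplacian, lap, hx, Finset.sum_sub_distrib]

theorem IsWeakPartial.aestronglyMeasurable (h : IsWeakPartial Ω i u v) :
    AEStronglyMeasurable v (volume.restrict (Ω : Set (EuclideanSpace ℝ (Fin N)))) :=
  h.2.1.aestronglyMeasurable

theorem le_h2Norm_of_sq_le {a : ℝ≥0∞}
    (h : a ^ 2 ≤ l2Norm Ω u ^ 2 + ∑ i, l2Norm Ω (weakPartial Ω i u) ^ 2 +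
      ∑ i, ∑ j, l2Norm Ω (weakPartial Ω j (weakPartial Ω i u)) ^ 2) : a ≤ h2Norm Ω u := by
  unfold h2Norm
  calc a = (a ^ 2) ^ (1 / 2 : ℝ) := by
        rw [← ENNReal.rpow_two, ← ENNReal.rpow_mul]; norm_num
    _ ≤ _ := by gcongr

theorem l2Norm_le_h2Norm : l2Norm Ω u ≤ h2Norm Ω u :=
  le_h2Norm_of_sq_le (by rw [add_assoc]; exact le_self_add)

theorem l2Norm_weakPartial_weakPartial_le_h2Norm (i j : Fin N) :
    l2Norm Ω (weakPartial Ω j (weakPartial Ω i u)) ≤ h2Norm Ω u := by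
  refine le_h2Norm_of_sq_le (le_trans ?_ le_add_self)
  calc _ ≤ ∑ j, l2Norm Ω (weakPartial Ω j (weakPartial Ω i u)) ^ 2 :=
        Finset.single_le_sum (f := fun j => l2Norm Ω (weakPartial Ω j (weakPartial Ω i u)) ^ 2)
          (fun _ _ => zero_le) (Finset.mem_univ j)
    _ ≤ _ := Finset.single_le_sum
          (f := fun i => ∑ j, l2Norm Ω (weakPartial Ω j (weakPartial Ω i u)) ^ 2)
          (fun _ _ => zero_le) (Finset.mem_univ i)

theorem l2Norm_weakLaplacian_le
    (h : ∀ i, ∃ v, IsWeakPartial Ω i (weakPartial Ω i u) v) :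
    l2Norm Ω (weakLaplacian Ω u) ≤ N * h2Norm Ω u := by
  have hsum : weakLaplacian Ω u = ∑ i, weakPartial Ω i (weakPartial Ω i u) := by
    ext x; simp [weakLaplacian]
  calc l2Norm Ω (weakLaplacian Ω u) ≤ ∑ i, l2Norm Ω (weakPartial Ω i (weakPartial Ω i u)) := by
        rw [hsum]
        exact eLpNorm_sum_le
          (fun i _ => (isWeakPartial_weakPartial (h i)).aestronglyMeasurable) one_le_two
    _ ≤ ∑ _i : Fin N, h2Norm Ω u :=
        Finset.sum_le_sum fun i _ => l2Norm_weakPartial_weakPartial_le_h2Norm i i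
    _ = _ := by simp

theorem MemH2.l2Norm_weakLaplacian_lt_top (hu : MemH2 Ω u) :
    l2Norm Ω (weakLaplacian Ω u) < ∞ := by
  have h : MemLp (weakLaplacian Ω u) 2
      (volume.restrict (Ω : Set (EuclideanSpace ℝ (Fin N)))) :=
    memLp_finsetSum _ fun i _ => hu.memLp_second i i
  exact h.2

/-- Write `Δφ = Δu - Δ(u - φ)`; the last term tends to zero along an `H²` approximation, so the
bound for test functions survives with the same constant. -/
theorem MemH2.l2Norm_lap_le (hu : MemH2 Ω u) (hφ : IsTest φ) :
    l2Norm Ω (lap φ) ≤ l2Norm Ω (weakLaplacian Ω u) + N * h2Norm Ω (fun x => u x - φ x) := by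
  have h1 : lap φ =ᵐ[volume.restrict (Ω : Set (EuclideanSpace ℝ (Fin N)))]
      fun x => weakLaplacian Ω u x - weakLaplacian Ω (fun x => u x - φ x) x := by
    filter_upwards [hu.weakLaplacian_sub hφ] with x hx
    rw [hx]; ring
  have h2 : AEStronglyMeasurable (weakLaplacian Ω u)
      (volume.restrict (Ω : Set (EuclideanSpace ℝ (Fin N)))) :=
    (memLp_finsetSum Finset.univ fun i _ => hu.memLp_second i i).1
  have hlap : AEStronglyMeasurable (lap φ)
      (volume.restrict (Ω : Set (EuclideanSpace ℝ (Fin N)))) :=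
    (continuous_finsetSum _ fun i _ => ((hφ.pd i).pd i).continuous).aestronglyMeasurable
  have h3 : AEStronglyMeasurable (weakLaplacian Ω (fun x => u x - φ x))
      (volume.restrict (Ω : Set (EuclideanSpace ℝ (Fin N)))) :=
    (h2.sub hlap).congr (hu.weakLaplacian_sub hφ).symm
  calc l2Norm Ω (lap φ) ≤ l2Norm Ω (weakLaplacian Ω u) +
        l2Norm Ω (weakLaplacian Ω (fun x => u x - φ x)) := by
        unfold l2Norm
        rw [eLpNorm_congr_ae h1]
        exact eLpNorm_sub_le h2 h3 one_le_two
    _ ≤ _ := by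
        gcongr
        exact l2Norm_weakLaplacian_le fun i => ⟨_, hu.isWeakPartial_weakPartial_sub hφ i i⟩

end WeakDerivatives

/-! ### The embedding inequality -/

section Embedding

theorem sq_add_le_four_mul (x y : ℝ≥0∞) : (x + y) ^ 2 ≤ 4 * (x ^ 2 + y ^ 2) := by
  have key : ∀ a b : ℝ≥0∞, a ≤ b → (a + b) ^ 2 ≤ 4 * (a ^ 2 + b ^ 2) := fun a b h => by
    calc (a + b) ^ 2 ≤ (b + b) ^ 2 := by gcongr
      _ = 4 * b ^ 2 := by ring
      _ ≤ _ := by gcongr; exact le_add_self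
  rcases le_total x y with h | h
  · exact key x y h
  · rw [add_comm x, add_comm (x ^ 2)]; exact key y x h

theorem l2Norm_sq {N : ℕ} (Ω : Opens (EuclideanSpace ℝ (Fin N)))
    (f : EuclideanSpace ℝ (Fin N) → ℝ) : l2Norm Ω f ^ 2 =
      ∫⁻ x in (Ω : Set (EuclideanSpace ℝ (Fin N))), ‖f x‖ₑ ^ 2 := by
  rw [l2Norm, eLpNorm_eq_lintegral_rpow_enorm_toReal two_ne_zero ENNReal.ofNat_ne_top,
    ← ENNReal.rpow_two, ← ENNReal.rpow_mul]
  simp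

section

variable {N : ℕ} (Ω : Opens (EuclideanSpace ℝ (Fin N))) (f : EuclideanSpace ℝ (Fin N) → ℝ)

theorem lzWeight_eq (t : ℝ) :
    lzWeight Ω ∞ 2 (-1) t = ENNReal.ofReal (t ^ (-(1 / 2) : ℝ) *
      (logTerm (volume (Ω : Set (EuclideanSpace ℝ (Fin N)))).toReal t)⁻¹) := by
  rw [lzWeight, logTerm, Real.rpow_neg_one, mul_comm]
  norm_num

theorem lzQuasinorm_sq : lzQuasinorm Ω ∞ 2 (-1) f ^ 2 =
    ∫⁻ t in Set.Ioo 0 (volume (Ω : Set (EuclideanSpace ℝ (Fin N)))).toReal,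
      (ENNReal.ofReal (t ^ (-(1 / 2) : ℝ) *
        (logTerm (volume (Ω : Set (EuclideanSpace ℝ (Fin N)))).toReal t)⁻¹) *
          rearr Ω f t) ^ 2 := by
  rw [lzQuasinorm, eLpNorm_eq_lintegral_rpow_enorm_toReal two_ne_zero ENNReal.ofNat_ne_top,
    ← ENNReal.rpow_two, ← ENNReal.rpow_mul]
  simp only [ENNReal.toReal_ofNat, enorm_eq_self, ENNReal.rpow_two]
  norm_num
  simp only [lzWeight_eq]

theorem lzNorm_sq : lzNorm Ω ∞ 2 (-1) f ^ 2 =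
    ∫⁻ t in Set.Ioo 0 (volume (Ω : Set (EuclideanSpace ℝ (Fin N)))).toReal,
      (ENNReal.ofReal (t ^ (-(1 / 2) : ℝ) *
        (logTerm (volume (Ω : Set (EuclideanSpace ℝ (Fin N)))).toReal t)⁻¹) *
          (ENNReal.ofReal t⁻¹ * ∫⁻ τ in Set.Ioo 0 t, rearr Ω f τ)) ^ 2 := by
  rw [lzNorm, eLpNorm_eq_lintegral_rpow_enorm_toReal two_ne_zero ENNReal.ofNat_ne_top,
    ← ENNReal.rpow_two, ← ENNReal.rpow_mul]
  simp only [ENNReal.toReal_ofNat, enorm_eq_self, ENNReal.rpow_two]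
  norm_num
  exact setLIntegral_congr_fun measurableSet_Ioo fun t ht => by
    simp only [lzWeight_eq, maxRearr]
    rw [ENNReal.div_eq_inv_mul, ENNReal.ofReal_inv_of_pos ht.1]

theorem lzNorm_le_lzQuasinorm : lzNorm Ω ∞ 2 (-1) f ≤ 7 * lzQuasinorm Ω ∞ 2 (-1) f := by
  rw [← ENNReal.pow_le_pow_left_iff two_ne_zero, mul_pow, lzNorm_sq, lzQuasinorm_sq]
  refine (hardy_average_log (aemeasurable_rearr_mono Set.Ioo_subset_Ioi_self)).trans
    (le_of_eq ?_)
  norm_num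

end

variable {Ω : Opens (EuclideanSpace ℝ (Fin 4))}

/-- The constant of the embedding inequality. -/
noncomputable def embConst : ℝ := 23 * (2 * ballVol ^ (-(1 / 2) : ℝ))

/-- The estimate for test functions: the potential bound followed by the two Hardy inequalities.
Keeping the argument `t / 2` matches `rearr_le_rearr_half_add` and avoids a change of variables in
the weight. -/
theorem lintegral_rearr_half_sq_le (hΩ : volume (Ω : Set (EuclideanSpace ℝ (Fin 4))) ≠ ∞)
    (φ : 𝓓(Ω, ℝ)) :
    ∫⁻ t in Set.Ioo 0 (volume (Ω : Set (EuclideanSpace ℝ (Fin 4)))).toReal,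
      (ENNReal.ofReal (t ^ (-(1 / 2) : ℝ) *
        (logTerm (volume (Ω : Set (EuclideanSpace ℝ (Fin 4)))).toReal t)⁻¹) *
          rearr Ω φ (t / 2)) ^ 2 ≤ (ENNReal.ofReal embConst * l2Norm Ω (lap φ)) ^ 2 := by
  have hφ := isTest_testFunction φ
  set V := (volume (Ω : Set (EuclideanSpace ℝ (Fin 4)))).toReal with hV
  set g := hessSum φ with hg
  have hgm : Measurable g := hφ.continuous_hessSum.measurable
  have hg0 : ∀ x ∉ Ω, g x = 0 := fun x hx => hessSum_eq_zero fun h => hx (φ.tsupport_subset h)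
  set c := 2 * ballVol ^ (-(1 / 2) : ℝ) with hc
  have hc0 : 0 ≤ c := mul_nonneg zero_le_two (Real.rpow_nonneg ballVol_pos.le _)
  set w : ℝ → ℝ := fun t => t ^ (-(1 / 2) : ℝ) * (logTerm V t)⁻¹ with hw
  have hrm : AEMeasurable (rearr Ω g) (volume.restrict (Set.Ioo 0 V)) :=
    aemeasurable_rearr_mono Set.Ioo_subset_Ioi_self
  have hpt : ∀ t ∈ Set.Ioo 0 V, (ENNReal.ofReal (w t) * rearr Ω φ (t / 2)) ^ 2 ≤
      4 * ENNReal.ofReal c ^ 2 * ((ENNReal.ofReal t⁻¹ * ∫⁻ τ in Set.Ioo 0 t, rearr Ω g τ) ^ 2 +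
        (ENNReal.ofReal (w t) *
          ∫⁻ τ in Set.Ioo t V, ENNReal.ofReal (τ ^ (-(1 / 2) : ℝ)) * rearr Ω g τ) ^ 2) := by
    intro t ht
    have h1 := rearr_half_le (Ω := Ω) hφ.continuous.measurable hgm hg0 hΩ
      hφ.enorm_le_lintegral_ball ht.1
    -- The rearrangement vanishes beyond `|Ω|`, so the tail stops at `V`, as in `hardy_log`.
    have h2 : ∫⁻ τ in Set.Ioi t, ENNReal.ofReal (τ ^ (-(1 / 2) : ℝ)) * rearr Ω g τ =
        ∫⁻ τ in Set.Ioo t V, ENNReal.ofReal (τ ^ (-(1 / 2) : ℝ)) * rearr Ω g τ := by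
      rw [← Set.Ioc_union_Ioi_eq_Ioi ht.2.le,
        lintegral_union measurableSet_Ioi (Set.Ioc_disjoint_Ioi le_rfl),
        setLIntegral_congr (Ioo_ae_eq_Ioc (a := t) (b := V))]
      have h3 : ∫⁻ τ in Set.Ioi V, ENNReal.ofReal (τ ^ (-(1 / 2) : ℝ)) * rearr Ω g τ =
          ∫⁻ τ in Set.Ioi V, 0 := by
        refine setLIntegral_congr_fun measurableSet_Ioi fun τ hτ => ?_
        have hτ0 : 0 < τ := (ht.1.trans ht.2).trans hτ
        have h4 : rearr Ω g τ = 0 := rearr_eq_zero hτ0 (by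
          rw [← ENNReal.ofReal_toReal hΩ]
          exact (ENNReal.ofReal_lt_ofReal_iff hτ0).2 hτ)
        simp [h4]
      rw [h3]
      simp
    rw [h2] at h1
    have hl := one_le_logTerm ht
    have hw1 : ENNReal.ofReal (w t) * ENNReal.ofReal (t ^ (-(1 / 2) : ℝ)) ≤
        ENNReal.ofReal t⁻¹ := by
      have ht0 := Real.rpow_nonneg ht.1.le (-(1 / 2) : ℝ)
      rw [← ENNReal.ofReal_mul (mul_nonneg ht0 (inv_nonneg.2 (zero_le_one.trans hl)))]
      refine ENNReal.ofReal_le_ofReal ?_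
      have h5 : t ^ (-(1 / 2) : ℝ) * t ^ (-(1 / 2) : ℝ) = t⁻¹ := by
        rw [← Real.rpow_neg_one, ← Real.rpow_add ht.1]; norm_num
      calc w t * t ^ (-(1 / 2) : ℝ) ≤ t ^ (-(1 / 2) : ℝ) * 1 * t ^ (-(1 / 2) : ℝ) := by
            simp only [hw]
            gcongr
            exact inv_le_one_of_one_le₀ hl
        _ = _ := by rw [mul_one, h5]
    calc (ENNReal.ofReal (w t) * rearr Ω φ (t / 2)) ^ 2
        ≤ (ENNReal.ofReal (w t) * (ENNReal.ofReal c *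
            (ENNReal.ofReal (t ^ (-(1 / 2) : ℝ)) * (∫⁻ τ in Set.Ioo 0 t, rearr Ω g τ) +
            ∫⁻ τ in Set.Ioo t V, ENNReal.ofReal (τ ^ (-(1 / 2) : ℝ)) * rearr Ω g τ))) ^ 2 := by
          gcongr
      _ = ENNReal.ofReal c ^ 2 * ((ENNReal.ofReal (w t) * ENNReal.ofReal (t ^ (-(1 / 2) : ℝ))) *
            (∫⁻ τ in Set.Ioo 0 t, rearr Ω g τ) + ENNReal.ofReal (w t) *
            ∫⁻ τ in Set.Ioo t V, ENNReal.ofReal (τ ^ (-(1 / 2) : ℝ)) * rearr Ω g τ) ^ 2 := by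
          ring
      _ ≤ ENNReal.ofReal c ^ 2 * (ENNReal.ofReal t⁻¹ *
            (∫⁻ τ in Set.Ioo 0 t, rearr Ω g τ) + ENNReal.ofReal (w t) *
            ∫⁻ τ in Set.Ioo t V, ENNReal.ofReal (τ ^ (-(1 / 2) : ℝ)) * rearr Ω g τ) ^ 2 := by
          gcongr
      _ ≤ _ := by
          rw [mul_comm 4, mul_assoc]
          gcongr
          exact sq_add_le_four_mul _ _
  have hmeas1 : AEMeasurable (fun t => (ENNReal.ofReal t⁻¹ *
      ∫⁻ τ in Set.Ioo 0 t, rearr Ω g τ) ^ 2) (volume.restrict (Set.Ioo 0 V)) := by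
    have hmono : Monotone fun t => ∫⁻ τ in Set.Ioo 0 t, rearr Ω g τ := fun s t hst =>
      lintegral_mono_set (Set.Ioo_subset_Ioo_right hst)
    exact ((Measurable.mul (by fun_prop) hmono.measurable).pow_const 2).aemeasurable
  have hsupp : ∫⁻ x, ‖lap φ x‖ₑ ^ 2 =
      ∫⁻ x in (Ω : Set (EuclideanSpace ℝ (Fin 4))), ‖lap φ x‖ₑ ^ 2 := by
    rw [← lintegral_indicator Ω.isOpen.measurableSet]
    refine lintegral_congr fun x => ?_
    by_cases hx : x ∈ (Ω : Set (EuclideanSpace ℝ (Fin 4)))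
    · rw [Set.indicator_of_mem hx]
    · have : lap φ x = 0 := Finset.sum_eq_zero fun i _ =>
        image_eq_zero_of_notMem_tsupport fun h =>
          hx (tsupport_pd_testFunction φ (tsupport_pd_subset i _ h))
      rw [Set.indicator_of_notMem hx, this]; simp
  have hrg : ∫⁻ τ in Set.Ioo 0 V, rearr Ω g τ ^ 2 ≤ 16 * l2Norm Ω (lap φ) ^ 2 := by
    calc ∫⁻ τ in Set.Ioo 0 V, rearr Ω g τ ^ 2 ≤ ∫⁻ τ in Set.Ioi 0, rearr Ω g τ ^ 2 :=
          lintegral_mono_set Set.Ioo_subset_Ioi_self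
      _ ≤ ∫⁻ x in (Ω : Set (EuclideanSpace ℝ (Fin 4))), ‖g x‖ₑ ^ 2 :=
          lintegral_rearr_sq_le hgm.aemeasurable
      _ ≤ ∫⁻ x, ‖g x‖ₑ ^ 2 := setLIntegral_le_lintegral _ _
      _ ≤ _ := hφ.lintegral_hessSum_sq_le
      _ = _ := by rw [l2Norm_sq, hsupp]; norm_num
  calc _ ≤ ∫⁻ t in Set.Ioo 0 V, 4 * ENNReal.ofReal c ^ 2 *
        ((ENNReal.ofReal t⁻¹ * ∫⁻ τ in Set.Ioo 0 t, rearr Ω g τ) ^ 2 +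
        (ENNReal.ofReal (w t) *
          ∫⁻ τ in Set.Ioo t V, ENNReal.ofReal (τ ^ (-(1 / 2) : ℝ)) * rearr Ω g τ) ^ 2) :=
        setLIntegral_mono' measurableSet_Ioo hpt
    _ = 4 * ENNReal.ofReal c ^ 2 *
        ((∫⁻ t in Set.Ioo 0 V, (ENNReal.ofReal t⁻¹ * ∫⁻ τ in Set.Ioo 0 t, rearr Ω g τ) ^ 2) +
        ∫⁻ t in Set.Ioo 0 V, (ENNReal.ofReal (w t) *
          ∫⁻ τ in Set.Ioo t V, ENNReal.ofReal (τ ^ (-(1 / 2) : ℝ)) * rearr Ω g τ) ^ 2) := by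
        rw [lintegral_const_mul' _ _ (by finiteness), lintegral_add_left' hmeas1]
    _ ≤ 4 * ENNReal.ofReal c ^ 2 * (4 * (16 * l2Norm Ω (lap φ) ^ 2) +
          4 * (16 * l2Norm Ω (lap φ) ^ 2)) := by
        gcongr
        · exact (hardy_average hrm).trans (by gcongr)
        · exact (hardy_log hrm).trans (by gcongr)
    _ = 512 * (ENNReal.ofReal c ^ 2 * l2Norm Ω (lap φ) ^ 2) := by ring
    -- `512 = 4 · (4 · 16 + 4 · 16)` is rounded up to the square of the `23` in `embConst`.
    _ ≤ 529 * (ENNReal.ofReal c ^ 2 * l2Norm Ω (lap φ) ^ 2) := by gcongr; norm_num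
    _ = _ := by
        have h : ENNReal.ofReal embConst = 23 * ENNReal.ofReal c := by
          rw [embConst, ENNReal.ofReal_mul (by norm_num), ENNReal.ofReal_ofNat]
        rw [h]
        ring

/-- Fatou's lemma along approximating test functions. At each fixed `t` the Chebyshev error, a
multiple of `‖u - φₙ‖₂ (2/t)^(1/2)`, tends to zero; no uniformity in `t` is needed. -/
theorem lzQuasinorm_le (hΩ : volume (Ω : Set (EuclideanSpace ℝ (Fin 4))) ≠ ∞)
    {u : EuclideanSpace ℝ (Fin 4) → ℝ} (hu : MemH20 Ω u) :
    lzQuasinorm Ω ∞ 2 (-1) u ≤ ENNReal.ofReal embConst * l2Norm Ω (weakLaplacian Ω u) := by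
  set V := (volume (Ω : Set (EuclideanSpace ℝ (Fin 4)))).toReal with hV
  set L := l2Norm Ω (weakLaplacian Ω u) with hL
  have hε : ∀ n : ℕ, 0 < ((n : ℝ≥0∞) + 1)⁻¹ := fun n => by
    rw [ENNReal.inv_pos]; finiteness
  choose φ hφ using fun n : ℕ => hu.2 _ (hε n)
  have hlim : Filter.Tendsto (fun n => h2Norm Ω fun x => u x - φ n x) Filter.atTop (nhds 0) := by
    refine tendsto_of_tendsto_of_tendsto_of_le_of_le tendsto_const_nhds ?_
      (fun n => zero_le) (fun n => (hφ n).le)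
    have := (Filter.tendsto_add_atTop_iff_nat 1).2 ENNReal.tendsto_inv_nat_nhds_zero
    simpa using this
  set w : ℝ → ℝ := fun t => t ^ (-(1 / 2) : ℝ) * (logTerm V t)⁻¹ with hw
  rw [← ENNReal.pow_le_pow_left_iff two_ne_zero, lzQuasinorm_sq]
  have hpt : ∀ t ∈ Set.Ioo 0 V, (ENNReal.ofReal (w t) * rearr Ω u t) ^ 2 ≤
      Filter.liminf (fun n => (ENNReal.ofReal (w t) * rearr Ω (φ n) (t / 2)) ^ 2)
        Filter.atTop := by
    intro t ht
    set x := ENNReal.ofReal (w t) * rearr Ω u t with hx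
    set δ : ℕ → ℝ≥0∞ := fun n => ENNReal.ofReal (w t) *
      (h2Norm Ω (fun x => u x - φ n x) * ENNReal.ofReal (2 / t) ^ (1 / 2 : ℝ)) with hδ
    have hδ0 : Filter.Tendsto δ Filter.atTop (nhds 0) := by
      have h1 := ENNReal.Tendsto.const_mul (a := ENNReal.ofReal (w t))
        (ENNReal.Tendsto.mul_const (b := ENNReal.ofReal (2 / t) ^ (1 / 2 : ℝ)) hlim
          (Or.inr (by finiteness))) (Or.inr (by finiteness))
      simpa only [zero_mul, mul_zero] using h1
    -- Truncated subtraction keeps this meaningful even if `x` is infinite, as finiteness of `u*` is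
    -- not yet known.
    have hle : ∀ n, (x - δ n) ^ 2 ≤ (ENNReal.ofReal (w t) * rearr Ω (φ n) (t / 2)) ^ 2 := by
      intro n
      gcongr
      rw [tsub_le_iff_right, hx, hδ, ← mul_add]
      gcongr
      refine (rearr_le_rearr_half_add ht.1 (hu.1.memLp.1.aemeasurable.sub
        (isTest_testFunction (φ n)).continuous.aemeasurable)).trans ?_
      gcongr
      exact l2Norm_le_h2Norm
    have hlim2 : Filter.Tendsto (fun n => (x - δ n) ^ 2) Filter.atTop (nhds (x ^ 2)) := by
      have := ENNReal.Tendsto.sub (tendsto_const_nhds (x := x)) hδ0 (Or.inr ENNReal.zero_ne_top)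
      rw [tsub_zero] at this
      exact ENNReal.Tendsto.pow this
    rw [← hlim2.liminf_eq]
    exact Filter.liminf_le_liminf (Filter.Eventually.of_forall hle)
  have hmeas : ∀ n, AEMeasurable (fun t => (ENNReal.ofReal (w t) * rearr Ω (φ n) (t / 2)) ^ 2)
      (volume.restrict (Set.Ioo 0 V)) := by
    intro n
    have h1 := measurable_logTerm V
    have h2 : AEMeasurable (fun t => rearr Ω (φ n) (t / 2)) (volume.restrict (Set.Ioo 0 V)) := by
      refine aemeasurable_restrict_of_antitoneOn measurableSet_Ioo fun s hs t ht hst => ?_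
      exact rearr_antitoneOn (half_pos hs.1) (half_pos ht.1) (by linarith)
    exact (AEMeasurable.mul (by fun_prop) h2).pow_const 2
  calc ∫⁻ t in Set.Ioo 0 V, (ENNReal.ofReal (w t) * rearr Ω u t) ^ 2
      ≤ ∫⁻ t in Set.Ioo 0 V, Filter.liminf
          (fun n => (ENNReal.ofReal (w t) * rearr Ω (φ n) (t / 2)) ^ 2) Filter.atTop :=
        setLIntegral_mono' measurableSet_Ioo hpt
    _ ≤ Filter.liminf (fun n => ∫⁻ t in Set.Ioo 0 V,
          (ENNReal.ofReal (w t) * rearr Ω (φ n) (t / 2)) ^ 2) Filter.atTop :=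
        lintegral_liminf_le' hmeas
    _ ≤ Filter.liminf (fun n => (ENNReal.ofReal embConst *
          (L + (4 : ℕ) * h2Norm Ω fun x => u x - φ n x)) ^ 2) Filter.atTop := by
        refine Filter.liminf_le_liminf (Filter.Eventually.of_forall fun n => ?_)
        refine (lintegral_rearr_half_sq_le hΩ (φ n)).trans ?_
        gcongr
        exact hu.1.l2Norm_lap_le (isTest_testFunction (φ n))
    _ = _ := by
        refine Filter.Tendsto.liminf_eq ?_
        have h1 : Filter.Tendsto (fun n => L + (4 : ℕ) * h2Norm Ω fun x => u x - φ n x)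
            Filter.atTop (nhds L) := by
          have h2 := (ENNReal.Tendsto.const_mul (a := ((4 : ℕ) : ℝ≥0∞)) hlim
            (Or.inr (by finiteness))).const_add L
          simpa using h2
        exact ENNReal.Tendsto.pow (ENNReal.Tendsto.const_mul h1 (Or.inr ENNReal.ofReal_ne_top))

end Embedding

end LorentzZygmund

theorem mainTheorem6 (Ω : TopologicalSpace.Opens (EuclideanSpace ℝ (Fin 4)))
    (hΩ : Bornology.IsBounded (Ω : Set (EuclideanSpace ℝ (Fin 4)))) :
    ∃ C : ℝ≥0, ∀ u : EuclideanSpace ℝ (Fin 4) → ℝ, LorentzZygmund.MemH20 Ω u →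
      LorentzZygmund.MemLorentzZygmund Ω ∞ 2 (-1) u ∧
      LorentzZygmund.lzQuasinorm Ω ∞ 2 (-1) u ≤
        C * LorentzZygmund.l2Norm Ω (LorentzZygmund.weakLaplacian Ω u) ∧
      LorentzZygmund.lzNorm Ω ∞ 2 (-1) u ≤
        C * LorentzZygmund.l2Norm Ω (LorentzZygmund.weakLaplacian Ω u) ∧
      LorentzZygmund.lzNorm Ω ∞ 2 (-1) u ≤ C * LorentzZygmund.h2Norm Ω u := by
  have hV : volume (Ω : Set (EuclideanSpace ℝ (Fin 4))) ≠ ∞ := hΩ.measure_lt_top.ne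
  -- `28 = 7 · 4`: the factor `7` passes from `u*` to `u**`, and `4` from the Laplacian to the `H²`
  -- norm.
  refine ⟨28 * LorentzZygmund.embConst.toNNReal, fun u hu => ?_⟩
  set K : ℝ≥0∞ := ENNReal.ofReal LorentzZygmund.embConst with hK
  have hC : ((28 * LorentzZygmund.embConst.toNNReal : ℝ≥0) : ℝ≥0∞) = 28 * K := by
    rw [ENNReal.coe_mul]; rfl
  rw [hC]
  have h1 := LorentzZygmund.lzQuasinorm_le hV hu
  have h2 := LorentzZygmund.lzNorm_le_lzQuasinorm Ω u
  have h3 : LorentzZygmund.l2Norm Ω (LorentzZygmund.weakLaplacian Ω u) ≤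
      4 * LorentzZygmund.h2Norm Ω u := by
    simpa using LorentzZygmund.l2Norm_weakLaplacian_le fun i => hu.1.exists_second i i
  set L := LorentzZygmund.l2Norm Ω (LorentzZygmund.weakLaplacian Ω u) with hL
  have hLtop : L < ∞ := hu.1.l2Norm_weakLaplacian_lt_top
  have h4 : LorentzZygmund.lzNorm Ω ∞ 2 (-1) u ≤ 7 * (K * L) := h2.trans (by gcongr)
  refine ⟨⟨hu.1.memLp.1.aemeasurable, h1.trans_lt (ENNReal.mul_lt_top ENNReal.ofReal_lt_top hLtop)⟩,
    ?_, ?_, ?_⟩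
  · calc _ ≤ K * L := h1
      _ = 1 * (K * L) := (one_mul _).symm
      _ ≤ 28 * (K * L) := by gcongr; norm_num
      _ = _ := (mul_assoc _ _ _).symm
  · calc _ ≤ 7 * (K * L) := h4
      _ ≤ 28 * (K * L) := by gcongr; norm_num
      _ = _ := (mul_assoc _ _ _).symm
  · calc _ ≤ 7 * (K * L) := h4
      _ ≤ 7 * (K * (4 * LorentzZygmund.h2Norm Ω u)) := by gcongr
      _ = _ := by ring
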